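/- **Setting.** Let $\mathcal S$ be a measurable space, $\mathcal A$ a finite nonempty set, and $\mathcal M=(\mathcal S,\mathcal A,r,\mathbb P)$ a Markov decision process with measurable reward $r:\mathcal S\times\mathcal A\to[-1,1]$ and transition kernel $\mathbb P(\cdot|s,a)$. Assume the Bellman optimality equation: there are a bounded measurable $Q^*$ and $J^*\in[-1,1]$ with $J^*+Q^*(s,a)=r(s,a)+\mathbb E_{s'\sim\mathbb P(\cdot|s,a)}[V^*(s')]$ and $V^*(s)=\max_aQ^*(s,a)$ for all $(s,a)$. Put $\sigma=\mathrm{sp}(V^*)=\sup_{s,s'}|V^*(s)-V^*(s')|$ and assume $\sigma>0$. For a pair $(Q,J)$ with $V(s)=\max_aQ(s,a)$ let $\mathcal E(Q,J)(s,a)=Q(s,a)-r(s,a)-\mathbb E_{s'\sim\mathbb P(\cdot|s,a)}[V(s')]+J$. **Hypotheses.** Let $\mathcal H,\mathcal G$ be classes of hypotheses that are either all value-based or all model-based. Value-based: $f=(Q_f,J_f)$, with $Q_f$ measurable for $f\in\mathcal H$, and $f^*=(Q^*,J^*)$. Model-based: $f=(\mathbb P_f,r_f)$ is a transition kernel and a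 reward with values in $[-1,1]$; for $f\in\mathcal H$, $(Q_f,J_f)$ is a solution of the Bellman optimality equation of the model $f$; and $f^*=(\mathbb P,r)$ with $(Q_{f^*},J_{f^*})=(Q^*,J^*)$. Put $V_f=\max_aQ_f(\cdot,a)$ and $\mathcal E(f)=\mathcal E(Q_f,J_f)$. Let $\|f-g\|_\infty$ be the sup-norm distance (a kernel is regarded as the function $(s,a,B)\mapsto\mathbb P_f(B|s,a)$), and $\mathcal N_{\mathcal H\cup\mathcal G}(\rho)$ the least size of a $\rho$-cover of $\mathcal H\cup\mathcal G$ with centres in $\mathcal H\cup\mathcal G$. Let $l_{f'}(f,g,\zeta)\in\mathbb R^m$ be a measurable discrepancy function of $\zeta=(s,a,r(s,a),s')$, and let $\mathbb E_\zeta$ be the expectation over $s'\sim\mathbb P(\cdot|s,a)$. Fix constants $C_1,C_2,C_\ell,C_V,L>0$ and assume, for all $f',f,\tilde f\in\mathcal H$, $g,\tilde g\in\mathcal H\cup\mathcal G$ and all $\zeta$: * (realizability) $f^*\in\mathcal H$; * (boundedness) $\|l_{f'}(f,g,\zeta)\|_2\le C_\ell\,\sigma$ and $\sup_s|V_f(s)|\le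 C_V\,\sigma$; * (Lipschitz discrepancy) $\|l_{f'}(f,g,\zeta)-l_{f'}(\tilde f,\tilde g,\zeta)\|_2\le L(1+\sigma)\max\{\|f-\tilde f\|_\infty,\|g-\tilde g\|_\infty\}$; * (generalized completeness) there is $\mathcal P:\mathcal H\to\mathcal G$ with $\mathcal P(f^*)=f^*$ and $l_{f'}(f,g,\zeta)-l_{f'}(f,\mathcal P(f),\zeta)=\mathbb E_\zeta[l_{f'}(f,g,\zeta)]$. **AGEC.** For a horizon $T$ and $\epsilon=1/\sqrt T$ let $d_{\rm G}$ be the infimum of the $d>0$ such that for all $f_1,\dots,f_T\in\mathcal H$ and all $(s_t,a_t)$, with $\zeta_i$ a transition from $(s_i,a_i)$, $$\sum_{t=1}^T\mathcal E(f_t)(s_t,a_t)\le\Big[d\sum_{t=1}^T\sum_{i=1}^{t-1}\|\mathbb E_{\zeta_i}[l_{f_i}(f_t,f_t,\zeta_i)]\|_2^2\Big]^{1/2}+C_1\sigma\min\{d,T\}+T\epsilon,$$ and let $\kappa_{\rm G}$ be the infimum of the $\kappa>0$ such that for all $B>0$, all $f_1,\dots,f_T\in\mathcal H$ and all $(s_t,a_t)$: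 if $\sum_{i=1}^{t-1}\|\mathbb E_{\zeta_i}[l_{f_i}(f_t,f_t,\zeta_i)]\|_2^2\le B$ for all $t\le T$, then $$\sum_{t=1}^T\|\mathbb E_{\zeta_t}[l_{f_t}(f_t,f_t,\zeta_t)]\|_2^2\le\kappa B\log T+C_2\sigma^2\min\{\kappa,T\}+2T\epsilon^2.$$ **Algorithm LOOP** (with parameter $\beta$). Start from a given $s_1$. Let $\mathcal L_t(f,g)=\sum_{i\le t}\|l_{f_i}(f,g,\zeta_i)\|_2^2$ and $\Gamma_t(f)=\mathcal L_t(f,f)-\inf_{g\in\mathcal G}\mathcal L_t(f,g)$ with $\zeta_i=(s_i,a_i,r(s_i,a_i),s_{i+1})$. At step $t=1,\dots,T$: if $t=1$ or $\Gamma_{t-1}(f_{t-1})\ge4\beta$, choose $f_t$ maximizing $J_f$ over $\mathcal B_t=\{f\in\mathcal H:\Gamma_{t-1}(f)\le\beta\}$ (any $f_t\in\mathcal H$ if $\mathcal B_t=\emptyset$); otherwise $f_t=f_{t-1}$. Play $a_t\in\arg\max_aQ_{f_t}(s_t,a)$ and observe $r(s_t,a_t)$ and $s_{t+1}\sim\mathbb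 P(\cdot|s_t,a_t)$. The choices are measurable functions of the past. **Theorem (Regret).** There is a constant $K>0$, depending only on $C_1,C_2,C_\ell,C_V,L$, such that the following holds in every such setting. For every constant $c\ge K(1+\sigma+1/\sigma)$, every $\delta\in(0,1)$ and every horizon $T\ge1$ such that $\mathcal N_{\mathcal H\cup\mathcal G}(1/T)$, $d_{\rm G}$, $\kappa_{\rm G}$ (with $\epsilon=1/\sqrt T$) are finite, every run of LOOP with $$\beta=c\,\log\big(T\,\mathcal N^2_{\mathcal H\cup\mathcal G}(1/T)/\delta\big)\,\mathrm{sp}(V^*)$$ satisfies, with probability at least $1-5\delta$, $$\mathrm{Reg}(T)=\sum_{t=1}^T\big(J^*-r(s_t,a_t)\big)\le K\max\{1,1/\sigma\}\cdot\mathrm{sp}(V^*)\cdot d\,\sqrt{T\beta},\qquad d=\max\{1,\sqrt{d_{\rm G}},\kappa_{\rm G}\}.$$ -/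

import Mathlib

open MeasureTheory ProbabilityTheory
open scoped ENNReal

universe u v w

/-- An average-reward Markov decision process with state space `S` and action space `A`:
a Markov transition kernel and a deterministic measurable reward with values in `[-1, 1]`. -/
structure AMDP (S : Type*) (A : Type*) [MeasurableSpace S] [MeasurableSpace A] where
  P : Kernel (S × A) S
  markov : IsMarkovKernel P
  r : S → A → ℝ
  measurable_r : ∀ a, Measurable fun s => r s a
  abs_r_le : ∀ s a, |r s a| ≤ 1

/-- The greedy state function `V(s) = max_a Q(s, a)` (the maximum is over a finite set). -/
noncomputable def greedyValue {S A : Type*} (Q : S → A → ℝ) (s : S) : ℝ := ⨆ a, Q s a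

/-- The span `sp(V) = sup_{s, s'} |V(s) - V(s')|` (used for bounded `V` only). -/
noncomputable def span {S : Type*} (V : S → ℝ) : ℝ := ⨆ p : S × S, |V p.1 - V p.2|

/-- One observed transition `ζ = (s, a, r, s')`. -/
abbrev Transition (S A : Type*) := S × A × ℝ × S

namespace AMDP

variable {S A : Type*} [MeasurableSpace S] [MeasurableSpace A]

/-- The average-reward Bellman operator `(T_J Q)(s, a) = r(s, a) + E[max_a' Q(s', a')] - J`. -/
noncomputable def bellmanOp (M : AMDP S A) (Q : S → A → ℝ) (J : ℝ) (s : S) (a : A) : ℝ :=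
  M.r s a + (∫ x, greedyValue Q x ∂(M.P (s, a))) - J

/-- The Bellman error `E(Q, J)(s, a) = Q(s, a) - (T_J Q)(s, a)`. -/
noncomputable def bellmanError (M : AMDP S A) (Q : S → A → ℝ) (J : ℝ) (s : S) (a : A) : ℝ :=
  Q s a - M.bellmanOp Q J s a

/-- `(Q, J)` is a bounded measurable solution of the Bellman optimality equation
`J + Q(s, a) = r(s, a) + E[V(s')]`, `V(s) = max_a Q(s, a)`, with `J ∈ [-1, 1]`. -/
structure IsBellmanSolution (M : AMDP S A) (Q : S → A → ℝ) (J : ℝ) : Prop where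
  measurable : ∀ a, Measurable fun s => Q s a
  bounded : ∃ b : ℝ, ∀ s a, |Q s a| ≤ b
  J_mem : J ∈ Set.Icc (-1 : ℝ) 1
  equation : ∀ s a, J + Q s a = M.r s a + ∫ x, greedyValue Q x ∂(M.P (s, a))

/-- The observed transition `(s, a, r(s, a), s')`. -/
def transition (M : AMDP S A) (s : S) (a : A) (x : S) : Transition S A := (s, a, M.r s a, x)

end AMDP

/-- The two kinds of hypotheses. In the model-based case the kind carries the assignment
`f ↦ (Q_f, J_f)` of an optimal bias function and an optimal average reward to a model `f`. -/
inductive HypothesisKind (S : Type*) (A : Type*) [MeasurableSpace S] [MeasurableSpace A] where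
  | valueBased
  | modelBased (Q : AMDP S A → S → A → ℝ) (J : AMDP S A → ℝ)

namespace HypothesisKind

variable {S A : Type*} [MeasurableSpace S] [MeasurableSpace A]

/-- A value-based hypothesis is a pair `(Q_f, J_f)`; a model-based hypothesis is a pair
`(P_f, r_f)` of a transition kernel and a reward function. -/
def Hyp : HypothesisKind S A → Type _
  | valueBased => (S → A → ℝ) × ℝ
  | modelBased _ _ => AMDP S A

/-- The state-action bias function `Q_f`. -/
def Q : (k : HypothesisKind S A) → k.Hyp → S → A → ℝ
  | valueBased, f => Prod.fst f
  | modelBased q _, f => q f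

/-- The average reward `J_f`. -/
def J : (k : HypothesisKind S A) → k.Hyp → ℝ
  | valueBased, f => Prod.snd f
  | modelBased _ j, f => j f

/-- The state bias function `V_f = max_a Q_f(·, a)`. -/
noncomputable def V (k : HypothesisKind S A) (f : k.Hyp) : S → ℝ := greedyValue (k.Q f)

/-- The sup-norm distance of two hypotheses: of `(Q, J)` as functions in the value-based case,
and of `(P, r)` in the model-based case, where a kernel is seen as the function
`(s, a, B) ↦ P(B | s, a)`. -/
noncomputable def supDist : (k : HypothesisKind S A) → k.Hyp → k.Hyp → ℝ≥0∞
  | valueBased, f, g =>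
      max (⨆ (s : S) (a : A), edist (Prod.fst f s a) (Prod.fst g s a))
        (edist (Prod.snd f) (Prod.snd g))
  | modelBased _ _, f, g =>
      max (⨆ (x : S × A) (B : Set S) (_ : MeasurableSet B),
          edist ((AMDP.P f x).real B) ((AMDP.P g x).real B))
        (⨆ (s : S) (a : A), edist (AMDP.r f s a) (AMDP.r g s a))

/-- `H` is a hypothesis class of the given kind: in the value-based case all `Q_f` are
measurable; in the model-based case `(Q_f, J_f)` solves the Bellman optimality equation of the
model `f`. -/
def IsHypothesisClass : (k : HypothesisKind S A) → Set k.Hyp → Prop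
  | valueBased, H => ∀ f ∈ H, ∀ a, Measurable fun s => Prod.fst f s a
  | modelBased q j, H => ∀ f ∈ H, AMDP.IsBellmanSolution f (q f) (j f)

/-- `f` is the hypothesis `f*` of the true model `M` with optimal bias function `Q` and optimal
average reward `J`: the pair `(Q, J)` in the value-based case, the true model (whose induced
bias function and average reward are `Q` and `J`) in the model-based case. -/
def IsOptimalHypothesis : (k : HypothesisKind S A) → AMDP S A → (S → A → ℝ) → ℝ → k.Hyp → Prop
  | valueBased, _, Q, J, f => f = (Q, J)
  | modelBased q j, M, Q, J, f => f = M ∧ q M = Q ∧ j M = J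

/-- The `ρ`-covering number of a class of hypotheses in the sup-norm distance, with centres in
the class (`⊤` if there is no finite cover). -/
noncomputable def coveringNumber (k : HypothesisKind S A) (ρ : ℝ≥0∞) (F : Set k.Hyp) : ℕ∞ :=
  ⨅ (C : Finset k.Hyp) (_ : (C : Set k.Hyp) ⊆ F ∧ ∀ f ∈ F, ∃ g ∈ C, k.supDist f g ≤ ρ),
    (C.card : ℕ∞)

end HypothesisKind

/-- A discrepancy function `l f' f g ζ`, written `l_{f'}(f, g, ζ)` in the literature, with values
in `ℝ^m`. -/
abbrev Discrepancy {S A : Type*} [MeasurableSpace S] [MeasurableSpace A]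
    (k : HypothesisKind S A) (m : ℕ) :=
  k.Hyp → k.Hyp → k.Hyp → Transition S A → EuclideanSpace ℝ (Fin m)

namespace Discrepancy

variable {S A : Type*} [MeasurableSpace S] [MeasurableSpace A] {k : HypothesisKind S A} {m : ℕ}

/-- The expected discrepancy `E_ζ[l_{f'}(f, g, ζ)]` at `(s, a)`: the next state is drawn from the
true kernel `P(· | s, a)`. -/
noncomputable def expected (l : Discrepancy k m) (M : AMDP S A) (f' f g : k.Hyp) (s : S) (a : A) :
    EuclideanSpace ℝ (Fin m) :=
  ∫ x, l f' f g (M.transition s a x) ∂(M.P (s, a))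

/-- The discrepancies are measurable functions of the transition. -/
def IsMeasurable (l : Discrepancy k m) (H G : Set k.Hyp) : Prop :=
  ∀ f' ∈ H, ∀ f ∈ H, ∀ g ∈ H ∪ G, Measurable (l f' f g)

/-- Boundedness: `‖l_{f'}(f, g, ζ)‖ ≤ b` for all transitions `ζ` that can be observed. -/
def IsBoundedBy (l : Discrepancy k m) (M : AMDP S A) (H G : Set k.Hyp) (b : ℝ) : Prop :=
  ∀ f' ∈ H, ∀ f ∈ H, ∀ g ∈ H ∪ G, ∀ s a x, ‖l f' f g (M.transition s a x)‖ ≤ b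

/-- `l_{f'}(f, g, ζ)` is Lipschitz in `(f, g)` with respect to the sup-norm distance of
hypotheses, with constant `Λ`, uniformly in `f'` and `ζ`. -/
def IsLipschitz (l : Discrepancy k m) (M : AMDP S A) (H G : Set k.Hyp) (Λ : ℝ) : Prop :=
  ∀ f' ∈ H, ∀ f₁ ∈ H, ∀ f₂ ∈ H, ∀ g₁ ∈ H ∪ G, ∀ g₂ ∈ H ∪ G, ∀ s a x,
    edist (l f' f₁ g₁ (M.transition s a x)) (l f' f₂ g₂ (M.transition s a x)) ≤
      ENNReal.ofReal Λ * max (k.supDist f₁ f₂) (k.supDist g₁ g₂)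

/-- Generalized completeness of `H` in `G`, with operator `Φ : H → G` and optimal hypothesis
`fstar`: `l_{f'}(f, g, ζ) - l_{f'}(f, Φ f, ζ) = E_ζ[l_{f'}(f, g, ζ)]` and `Φ fstar = fstar`. -/
structure IsComplete (l : Discrepancy k m) (M : AMDP S A) (H G : Set k.Hyp)
    (Φ : k.Hyp → k.Hyp) (fstar : k.Hyp) : Prop where
  mapsTo : Set.MapsTo Φ H G
  decomposition : ∀ f' ∈ H, ∀ f ∈ H, ∀ g ∈ H ∪ G, ∀ s a x,
    l f' f g (M.transition s a x) - l f' f (Φ f) (M.transition s a x) = l.expected M f' f g s a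
  fixed : Φ fstar = fstar

/-- The constants `d > 0` for which Bellman dominance holds over `T` steps with burn-in constant
`C₁`, accuracy `ε`, and span `σ`. Steps are numbered `0, …, T - 1`. -/
def dominanceSet (l : Discrepancy k m) (M : AMDP S A) (H : Set k.Hyp) (T : ℕ)
    (C₁ σ ε : ℝ) : Set ℝ :=
  {d | 0 < d ∧ ∀ (f : ℕ → k.Hyp) (s : ℕ → S) (a : ℕ → A), (∀ t, f t ∈ H) →
    ∑ t ∈ Finset.range T, M.bellmanError (k.Q (f t)) (k.J (f t)) (s t) (a t) ≤
      √(d * ∑ t ∈ Finset.range T, ∑ i ∈ Finset.range t,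
          ‖l.expected M (f i) (f t) (f t) (s i) (a i)‖ ^ 2) +
        C₁ * σ * min d T + T * ε}

/-- The constants `κ > 0` for which transferability holds over `T` steps with burn-in constant
`C₂`, accuracy `ε`, and span `σ`. -/
def transferabilitySet (l : Discrepancy k m) (M : AMDP S A) (H : Set k.Hyp) (T : ℕ)
    (C₂ σ ε : ℝ) : Set ℝ :=
  {κ | 0 < κ ∧ ∀ (β : ℝ) (f : ℕ → k.Hyp) (s : ℕ → S) (a : ℕ → A), 0 < β → (∀ t, f t ∈ H) →
    (∀ t < T, ∑ i ∈ Finset.range t,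
      ‖l.expected M (f i) (f t) (f t) (s i) (a i)‖ ^ 2 ≤ β) →
    ∑ t ∈ Finset.range T, ‖l.expected M (f t) (f t) (f t) (s t) (a t)‖ ^ 2 ≤
      κ * β * Real.log T + C₂ * σ ^ 2 * min κ T + 2 * T * ε ^ 2}

/-- The dominance coefficient `d_G`: the smallest constant in Bellman dominance. -/
noncomputable def dominanceCoeff (l : Discrepancy k m) (M : AMDP S A) (H : Set k.Hyp) (T : ℕ)
    (C₁ σ ε : ℝ) : ℝ :=
  sInf (l.dominanceSet M H T C₁ σ ε)

/-- The transferability coefficient `κ_G`: the smallest constant in transferability. -/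
noncomputable def transferabilityCoeff (l : Discrepancy k m) (M : AMDP S A) (H : Set k.Hyp)
    (T : ℕ) (C₂ σ ε : ℝ) : ℝ :=
  sInf (l.transferabilitySet M H T C₂ σ ε)

/-- The cumulative squared discrepancy of `(f, g)` on the first `t` observed transitions of the
trajectory `(fs, s, a)`. -/
noncomputable def loss (l : Discrepancy k m) (M : AMDP S A) (fs : ℕ → k.Hyp) (s : ℕ → S)
    (a : ℕ → A) (t : ℕ) (f g : k.Hyp) : ℝ :=
  ∑ i ∈ Finset.range t, ‖l (fs i) f g (M.transition (s i) (a i) (s (i + 1)))‖ ^ 2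

/-- The excess loss `L(f, f) - inf_{g ∈ G} L(f, g)` on the first `t` observed transitions. -/
noncomputable def excessLoss (l : Discrepancy k m) (M : AMDP S A) (G : Set k.Hyp)
    (fs : ℕ → k.Hyp) (s : ℕ → S) (a : ℕ → A) (t : ℕ) (f : k.Hyp) : ℝ :=
  l.loss M fs s a t f f - ⨅ g : G, l.loss M fs s a t f g

/-- The confidence set before step `t`: the hypotheses in `H` with excess loss at most `β`. -/
def confidenceSet (l : Discrepancy k m) (M : AMDP S A) (H G : Set k.Hyp) (β : ℝ)
    (fs : ℕ → k.Hyp) (s : ℕ → S) (a : ℕ → A) (t : ℕ) : Set k.Hyp :=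
  {f ∈ H | l.excessLoss M G fs s a t f ≤ β}

/-- The hypothesis is updated at step `t`: this is the first step, or the excess loss of the
current hypothesis is at least `4β`. -/
def IsUpdate (l : Discrepancy k m) (M : AMDP S A) (G : Set k.Hyp) (β : ℝ)
    (fs : ℕ → k.Hyp) (s : ℕ → S) (a : ℕ → A) (t : ℕ) : Prop :=
  t = 0 ∨ 4 * β ≤ l.excessLoss M G fs s a t (fs (t - 1))

end Discrepancy

/-- A run of the algorithm LOOP for `T` steps (numbered `0, …, T - 1`) on a probability space
`(Ω, μ)`, with states `s`, actions `a`, hypotheses `fs`, and with `ℱ t` the information that is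
available when the action of step `t` has been chosen. -/
structure LoopRun {S A : Type*} [MeasurableSpace S] [MeasurableSpace A]
    (M : AMDP S A) (k : HypothesisKind S A) (H G : Set k.Hyp) {m : ℕ} (l : Discrepancy k m)
    (T : ℕ) (β : ℝ) (s₁ : S) {Ω : Type*} [mΩ : MeasurableSpace Ω] (μ : Measure Ω)
    (ℱ : Filtration ℕ mΩ) (s : ℕ → Ω → S) (a : ℕ → Ω → A) (fs : ℕ → Ω → k.Hyp) : Prop where
  /-- the initial state is the given one -/
  init : ∀ ω, s 0 ω = s₁
  /-- states and actions are adapted -/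
  measurable_s : ∀ t ≤ T, Measurable[ℱ t] (s t)
  measurable_a : ∀ t < T, Measurable[ℱ t] (a t)
  /-- the hypotheses are selected in a measurable, non-anticipating way -/
  measurable_Q : ∀ t < T, ∀ b : A,
    Measurable[(ℱ t).prod inferInstance] fun p : Ω × S => k.Q (fs t p.1) p.2 b
  measurable_l : ∀ t < T, ∀ f ∈ H, ∀ g ∈ H ∪ G,
    Measurable[(ℱ t).prod inferInstance] fun p : Ω × Transition S A => l (fs t p.1) f g p.2
  /-- given the past, the next state is drawn from `P(· | s_t, a_t)` -/
  transition_law : ∀ t < T, ∀ B : Set S, MeasurableSet B → ∀ E : Set Ω, MeasurableSet[ℱ t] E →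
    μ (E ∩ s (t + 1) ⁻¹' B) = ∫⁻ ω in E, M.P (s t ω, a t ω) B ∂μ
  /-- all hypotheses are in the class -/
  mem : ∀ t < T, ∀ ω, fs t ω ∈ H
  /-- at an update the hypothesis has the largest average reward in the confidence set
  (an arbitrary hypothesis is kept if the confidence set is empty) -/
  update : ∀ t < T, ∀ ω,
    l.IsUpdate M G β (fun i => fs i ω) (fun i => s i ω) (fun i => a i ω) t →
    (l.confidenceSet M H G β (fun i => fs i ω) (fun i => s i ω) (fun i => a i ω) t).Nonempty →
      fs t ω ∈
          l.confidenceSet M H G β (fun i => fs i ω) (fun i => s i ω) (fun i => a i ω) t ∧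
        ∀ f ∈ l.confidenceSet M H G β (fun i => fs i ω) (fun i => s i ω) (fun i => a i ω) t,
          k.J f ≤ k.J (fs t ω)
  /-- without an update the hypothesis is retained -/
  retain : ∀ t < T, ∀ ω,
    ¬ l.IsUpdate M G β (fun i => fs i ω) (fun i => s i ω) (fun i => a i ω) t →
      fs t ω = fs (t - 1) ω
  /-- the action is greedy for the current hypothesis -/
  greedy : ∀ t < T, ∀ ω, ∀ b : A, k.Q (fs t ω) (s t ω) b ≤ k.Q (fs t ω) (s t ω) (a t ω)

/-- The regret `∑_t (J* - r(s_t, a_t))` over `T` steps. -/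
noncomputable def regret {S A : Type*} [MeasurableSpace S] [MeasurableSpace A] (M : AMDP S A)
    (Jstar : ℝ) (T : ℕ) (s : ℕ → S) (a : ℕ → A) : ℝ :=
  ∑ t ∈ Finset.range T, (Jstar - M.r (s t) (a t))

/-- The optimism parameter `β = c · log(T · N² / δ) · σ`. -/
noncomputable def optimismParam (c : ℝ) (T N : ℕ) (δ σ : ℝ) : ℝ :=
  c * Real.log (T * (N : ℝ) ^ 2 / δ) * σ

/-!
Regret of LOOP by optimism under controlled noise. Write `e` for the conditional mean
`E_ζ[l_{f'}(f, g, ζ)]`. By generalized completeness, `l_{f'}(f, Φ f, ζ)` is the centred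
discrepancy, so that `‖l_{f'}(f, g, ζ)‖² - ‖l_{f'}(f, Φ f, ζ)‖²` equals `‖e‖²` plus the noise
`2 ⟨e, l_{f'}(f, Φ f, ζ)⟩`. The noise is centred and of size at most `2 ‖e‖ C_ℓ σ`, so Hoeffding's
lemma with tilting parameter `1 / (4 C_ℓ² σ²)` compensates it by `‖e‖² / 2`
(`lintegral_exp_noise_le_one`). The resulting exponential supermartingale, Markov's inequality and
a union bound over the windows of steps, the two signs and a `2/T`-cover show that, with
probability at least `1 - 2δ`, the noise over every window and for all `f`, `g` is at most half of
the accumulated `‖e‖²` plus `β / 4` (`LoopRun.measureReal_exists_noise_gt`).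

The rest is deterministic on this event. The optimal hypothesis has `e = 0` and so stays in all
confidence sets, whence `J* ≤ J_{f_t}` (`Discrepancy.NoiseControlled.optimism`). The rule for
updates keeps the excess loss of `f_t` at most `4β`, so its squared conditional means over the
past sum to at most `9β` (`Discrepancy.NoiseControlled.sum_norm_sq_expected_le`). Between two
updates the excess loss of the current hypothesis grows from `β` to `4β`, so the squared
conditional means on the played steps accumulate to at least `β`
(`Discrepancy.NoiseControlled.le_sum_between_updates`); transferability bounds their total, hence
the number of updates by `O(κ √T)`.

Finally, optimism and the greedy choice of actions bound the regret by the sum of the Bellman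
errors, a martingale in the values of the next states, and the telescoping sum of value increments
(`regret_le_of_optimism`). Dominance bounds the first by `O(√(d T β))`, Hoeffding's inequality the
second with probability at least `1 - δ`, and the third is at most `2 C_V σ` per update. If
`δ ≥ 1/5` there is nothing to prove; otherwise the logarithm in `β` is at least `1`, and `β` exceeds
all lower-order terms.
-/

/-! ### Exponential supermartingales -/

/-- Disintegration of the joint law of `(Y, X)` when `κ` is the conditional law of `X` given `Y`.
The target `Ω'` of `Y` is a separate type so that it can be `Ω` with a smaller σ-algebra. -/
theorem lintegral_prodMk_eq_of_kernel {Ω Ω' S : Type*} [MeasurableSpace Ω] [MeasurableSpace Ω']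
    [MeasurableSpace S] {μ : Measure Ω} [IsFiniteMeasure μ] {Y : Ω → Ω'} (hY : Measurable Y)
    {X : Ω → S} (hX : Measurable X) (κ : Kernel Ω' S) [IsMarkovKernel κ]
    (hlaw : ∀ B : Set S, MeasurableSet B → ∀ E : Set Ω', MeasurableSet E →
      μ (Y ⁻¹' E ∩ X ⁻¹' B) = ∫⁻ ω in Y ⁻¹' E, κ (Y ω) B ∂μ)
    {F : Ω' × S → ℝ≥0∞} (hF : Measurable F) :
    ∫⁻ ω, F (Y ω, X ω) ∂μ = ∫⁻ ω, ∫⁻ x, F (Y ω, x) ∂(κ (Y ω)) ∂μ := by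
  have key : μ.map (fun ω => (Y ω, X ω)) = (μ.map Y) ⊗ₘ κ := by
    refine Measure.ext_prod fun {E B} hE hB => ?_
    rw [Measure.map_apply (hY.prodMk hX) (hE.prod hB), Measure.compProd_apply_prod hE hB,
      setLIntegral_map hE (κ.measurable_coe hB) hY, ← hlaw B hB E hE]
    rfl
  rw [← lintegral_map hF (hY.prodMk hX), key, Measure.lintegral_compProd hF,
    lintegral_map hF.lintegral_kernel_prod_right' hY]

theorem measurable_increment {Ω S : Type*} [mΩ : MeasurableSpace Ω] [MeasurableSpace S]
    {ℱ : Filtration ℕ mΩ} {T : ℕ} {X : ℕ → Ω → S} (hX : ∀ t ≤ T, Measurable[ℱ t] (X t))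
    {F : ℕ → Ω × S → ℝ} (hF : ∀ t < T, Measurable[(ℱ t).prod inferInstance] (F t))
    {i t : ℕ} (hi : i < t) (ht : t ≤ T) : Measurable[ℱ t] fun ω => F i (ω, X (i + 1) ω) := by
  refine (hF i (by omega)).comp ?_
  exact @Measurable.prodMk Ω (ℱ t) Ω S (ℱ i) _ _ _
    (measurable_id.mono (ℱ.mono hi.le) le_rfl)
    ((hX (i + 1) (by omega)).mono (ℱ.mono hi) le_rfl)

/-- An exponential supermartingale: if each increment `F t (ω, X (t + 1) ω)` has conditional
exponential moment at most `1` given the past, then so has their sum. -/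
theorem lintegral_exp_sum_le_one {Ω S : Type*} [mΩ : MeasurableSpace Ω] [MeasurableSpace S]
    {μ : Measure Ω} [IsProbabilityMeasure μ] {ℱ : Filtration ℕ mΩ} {T : ℕ} {X : ℕ → Ω → S}
    (hX : ∀ t ≤ T, Measurable[ℱ t] (X t)) (ν : ℕ → Ω → Measure S)
    (hlaw : ∀ t < T, ∀ F : Ω × S → ℝ≥0∞, Measurable[(ℱ t).prod inferInstance] F →
      ∫⁻ ω, F (ω, X (t + 1) ω) ∂μ = ∫⁻ ω, ∫⁻ x, F (ω, x) ∂(ν t ω) ∂μ)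
    (F : ℕ → Ω × S → ℝ) (hF : ∀ t < T, Measurable[(ℱ t).prod inferInstance] (F t))
    (h1 : ∀ t < T, ∀ ω, ∫⁻ x, ENNReal.ofReal (Real.exp (F t (ω, x))) ∂(ν t ω) ≤ 1) :
    ∀ t ≤ T, ∫⁻ ω, ENNReal.ofReal
      (Real.exp (∑ i ∈ Finset.range t, F i (ω, X (i + 1) ω))) ∂μ ≤ 1 := by
  intro t
  induction t with
  | zero => simp
  | succ t ih =>
    intro ht
    have hsum : Measurable[ℱ t] fun ω => ∑ i ∈ Finset.range t, F i (ω, X (i + 1) ω) :=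
      Finset.measurable_fun_sum _ fun i hi =>
        measurable_increment hX hF (Finset.mem_range.1 hi) (by omega)
    have hE1 : Measurable[(ℱ t).prod inferInstance] fun p : Ω × S => ENNReal.ofReal
        (Real.exp (∑ i ∈ Finset.range t, F i (p.1, X (i + 1) p.1))) :=
      ENNReal.measurable_ofReal.comp (Real.measurable_exp.comp
        (hsum.comp (@measurable_fst _ _ (ℱ t) _)))
    have hE2 : Measurable[(ℱ t).prod inferInstance] fun p : Ω × S => ENNReal.ofReal
        (Real.exp (F t p)) :=
      ENNReal.measurable_ofReal.comp (Real.measurable_exp.comp (hF t ht))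
    have := hlaw t ht _ (hE1.mul hE2)
    simp only [Pi.mul_apply] at this
    simp only [Finset.sum_range_succ, Real.exp_add, ENNReal.ofReal_mul (Real.exp_nonneg _)]
    rw [this]
    refine le_trans (lintegral_mono fun ω => ?_) (ih (by omega))
    refine (lintegral_const_mul' _ _ ENNReal.ofReal_ne_top).le.trans ?_
    exact mul_le_of_le_one_right' (h1 t ht ω)

/-- Markov's inequality for the exponential supermartingale, over a window of steps. -/
theorem measureReal_le_sum_le_exp_neg {Ω S : Type*} [mΩ : MeasurableSpace Ω] [MeasurableSpace S]
    {μ : Measure Ω} [IsProbabilityMeasure μ] {ℱ : Filtration ℕ mΩ} {T : ℕ} {X : ℕ → Ω → S}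
    (hX : ∀ t ≤ T, Measurable[ℱ t] (X t)) (ν : ℕ → Ω → Measure S)
    [∀ t ω, IsProbabilityMeasure (ν t ω)]
    (hlaw : ∀ t < T, ∀ F : Ω × S → ℝ≥0∞, Measurable[(ℱ t).prod inferInstance] F →
      ∫⁻ ω, F (ω, X (t + 1) ω) ∂μ = ∫⁻ ω, ∫⁻ x, F (ω, x) ∂(ν t ω) ∂μ)
    (F : ℕ → Ω × S → ℝ) (hF : ∀ t < T, Measurable[(ℱ t).prod inferInstance] (F t))
    (h1 : ∀ t < T, ∀ ω, ∫⁻ x, ENNReal.ofReal (Real.exp (F t (ω, x))) ∂(ν t ω) ≤ 1)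
    (t₀ : ℕ) {t : ℕ} (ht : t ≤ T) (τ : ℝ) :
    μ.real {ω | τ ≤ ∑ i ∈ Finset.Ico t₀ t, F i (ω, X (i + 1) ω)} ≤ Real.exp (-τ) := by
  -- the increments before `t₀` are replaced by `0`
  let F' : ℕ → Ω × S → ℝ := fun i p => if t₀ ≤ i then F i p else 0
  have hF' : ∀ t < T, Measurable[(ℱ t).prod inferInstance] (F' t) := by
    intro i hi
    by_cases h : t₀ ≤ i
    · simpa [F', h] using hF i hi
    · simp only [F', h, if_false]
      exact measurable_const
  have hle : ∫⁻ ω, ENNReal.ofReal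
      (Real.exp (∑ i ∈ Finset.range t, F' i (ω, X (i + 1) ω))) ∂μ ≤ 1 := by
    refine lintegral_exp_sum_le_one hX ν hlaw F' hF' (fun i hi ω => ?_) t ht
    by_cases h : t₀ ≤ i
    · simpa [F', h] using h1 i hi ω
    · simp [F', h]
  have hsum : ∀ ω, ∑ i ∈ Finset.range t, F' i (ω, X (i + 1) ω)
      = ∑ i ∈ Finset.Ico t₀ t, F i (ω, X (i + 1) ω) := by
    intro ω
    rw [← Finset.sum_filter]
    congr 1
    ext i
    simp [and_comm]
  simp only [hsum] at hle
  have hmeas : Measurable fun ω => ENNReal.ofReal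
      (Real.exp (∑ i ∈ Finset.Ico t₀ t, F i (ω, X (i + 1) ω))) :=
    ENNReal.measurable_ofReal.comp (Real.measurable_exp.comp
      (Finset.measurable_fun_sum _ fun i hi =>
        (measurable_increment hX hF (Finset.mem_Ico.1 hi).2 ht).mono (ℱ.le t) le_rfl))
  have hmk := (mul_meas_ge_le_lintegral hmeas (ENNReal.ofReal (Real.exp τ))).trans hle
  have hset : {ω | ENNReal.ofReal (Real.exp τ) ≤ ENNReal.ofReal
      (Real.exp (∑ i ∈ Finset.Ico t₀ t, F i (ω, X (i + 1) ω)))}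
      = {ω | τ ≤ ∑ i ∈ Finset.Ico t₀ t, F i (ω, X (i + 1) ω)} := by
    ext ω
    simp [ENNReal.ofReal_le_ofReal_iff (Real.exp_nonneg _)]
  rw [hset] at hmk
  have := ENNReal.toReal_mono ENNReal.one_ne_top hmk
  rw [ENNReal.toReal_mul, ENNReal.toReal_ofReal (Real.exp_nonneg _), ENNReal.toReal_one] at this
  rw [Real.exp_neg, ← one_div, le_div_iff₀ (Real.exp_pos _), mul_comm]
  exact this

/-- Hoeffding's lemma for a centred bounded variable, normalized to exponential moment at most
`1`. -/
theorem lintegral_exp_sub_le_one {S : Type*} [MeasurableSpace S] {ν : Measure S}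
    [IsProbabilityMeasure ν] {Y : S → ℝ} (hY : Measurable Y) {b : ℝ} (hb : ∀ x, |Y x| ≤ b)
    (h0 : ∫ x, Y x ∂ν = 0) (θ : ℝ) {v : ℝ} (hv : θ ^ 2 * b ^ 2 / 2 ≤ v) :
    ∫⁻ x, ENNReal.ofReal (Real.exp (θ * Y x - v)) ∂ν ≤ 1 := by
  have hs := hasSubgaussianMGF_of_mem_Icc_of_integral_eq_zero (a := -b) (b := b) (μ := ν)
    hY.aemeasurable (ae_of_all _ fun x => abs_le.1 (hb x)) h0
  have hm := hs.mgf_le θ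
  have hi : Integrable (fun x => Real.exp (θ * Y x - v)) ν := by
    simpa only [Real.exp_sub, div_eq_mul_inv] using (hs.integrable_exp_mul θ).mul_const _
  rw [← ofReal_integral_eq_lintegral_ofReal hi (ae_of_all _ fun x => (Real.exp_pos _).le),
    ← ENNReal.ofReal_one]
  refine ENNReal.ofReal_le_ofReal ?_
  simp only [Real.exp_sub, integral_div]
  rw [div_le_one (Real.exp_pos _)]
  refine hm.trans (Real.exp_le_exp.2 (le_trans (le_of_eq ?_) hv))
  have : ((‖b - -b‖₊ / 2 : NNReal) : ℝ) ^ 2 = b ^ 2 := by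
    simp only [NNReal.coe_div, coe_nnnorm, Real.norm_eq_abs, NNReal.coe_ofNat,
      sub_neg_eq_add, div_pow, sq_abs]
    ring
  push_cast at this ⊢
  rw [this]; ring

/-! ### The noise of the discrepancies along a run -/

instance {S A : Type*} [MeasurableSpace S] [MeasurableSpace A] (M : AMDP S A) :
    IsMarkovKernel M.P := M.markov

section Measurability

variable {S A : Type*} [MeasurableSpace S] [MeasurableSpace A] [Finite A] (M : AMDP S A)
  {k : HypothesisKind S A}

theorem measurable_V {Ω : Type*} [MeasurableSpace Ω] {ff : Ω → k.Hyp}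
    (hQ : ∀ b, Measurable fun p : Ω × S => k.Q (ff p.1) p.2 b) :
    Measurable fun p : Ω × S => k.V (ff p.1) p.2 :=
  Measurable.iSup hQ

theorem measurable_value_increment {Ω : Type*} [MeasurableSpace Ω] {ff : Ω → k.Hyp}
    {s : Ω → S} {a : Ω → A} (hs : Measurable s) (ha : Measurable a)
    (hQ : ∀ b, Measurable fun p : Ω × S => k.Q (ff p.1) p.2 b) :
    Measurable fun p : Ω × S =>
      (∫ x, k.V (ff p.1) x ∂(M.P (s p.1, a p.1))) - k.V (ff p.1) p.2 := by
  have h : Measurable fun ω => ∫ x, k.V (ff ω) x ∂(M.P (s ω, a ω)) :=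
    ((measurable_V hQ).stronglyMeasurable.integral_kernel_prod_right'
      (κ := M.P.comap (fun ω => (s ω, a ω)) (hs.prodMk ha))).measurable
  exact (h.comp measurable_fst).sub (measurable_V hQ)

variable [DiscreteMeasurableSpace A]

theorem AMDP.measurable_transition :
    Measurable fun p : S × A × S => M.transition p.1 p.2.1 p.2.2 := by
  have hr : Measurable fun q : A × S => M.r q.2 q.1 :=
    measurable_from_prod_countable_right fun a => M.measurable_r a
  exact measurable_fst.prodMk (measurable_snd.fst.prodMk
    ((hr.comp (measurable_snd.fst.prodMk measurable_fst)).prodMk measurable_snd.snd))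

variable {m : ℕ}

theorem measurable_discrepancy_transition {Ω : Type*} [MeasurableSpace Ω] (l : Discrepancy k m)
    {ff : Ω → k.Hyp} {s : Ω → S} {a : Ω → A} (hs : Measurable s) (ha : Measurable a)
    {f g : k.Hyp} (hl : Measurable fun p : Ω × Transition S A => l (ff p.1) f g p.2) :
    Measurable fun p : Ω × S => l (ff p.1) f g (M.transition (s p.1) (a p.1) p.2) :=
  hl.comp (measurable_fst.prodMk (M.measurable_transition.comp
    ((hs.comp measurable_fst).prodMk ((ha.comp measurable_fst).prodMk measurable_snd))))

theorem measurable_expected {Ω : Type*} [MeasurableSpace Ω] (l : Discrepancy k m)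
    {ff : Ω → k.Hyp} {s : Ω → S} {a : Ω → A} (hs : Measurable s) (ha : Measurable a)
    {f g : k.Hyp} (hl : Measurable fun p : Ω × Transition S A => l (ff p.1) f g p.2) :
    Measurable fun ω => l.expected M (ff ω) f g (s ω) (a ω) :=
  ((measurable_discrepancy_transition M l hs ha hl).stronglyMeasurable.integral_kernel_prod_right'
    (κ := M.P.comap (fun ω => (s ω, a ω)) (hs.prodMk ha))).measurable

/-- The cross term `2 ⟨e, l - e⟩` in the expansion of the square of a discrepancy `l` around its
conditional mean `e`. It has conditional mean zero. -/
noncomputable def Discrepancy.noise (l : Discrepancy k m) (M : AMDP S A) (f' f g : k.Hyp)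
    (s : S) (a : A) (x : S) : ℝ :=
  2 * inner ℝ (l.expected M f' f g s a)
    (l f' f g (M.transition s a x) - l.expected M f' f g s a)

theorem measurable_noise {Ω : Type*} [MeasurableSpace Ω] (l : Discrepancy k m)
    {ff : Ω → k.Hyp} {s : Ω → S} {a : Ω → A} (hs : Measurable s) (ha : Measurable a)
    {f g : k.Hyp} (hl : Measurable fun p : Ω × Transition S A => l (ff p.1) f g p.2) :
    Measurable fun p : Ω × S => l.noise M (ff p.1) f g (s p.1) (a p.1) p.2 := by
  have he : Measurable fun p : Ω × S => l.expected M (ff p.1) f g (s p.1) (a p.1) :=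
    (measurable_expected M l hs ha hl).comp measurable_fst
  exact (he.inner ((measurable_discrepancy_transition M l hs ha hl).sub he)).const_mul 2

theorem measurable_tilted_noise {Ω : Type*} [MeasurableSpace Ω] (l : Discrepancy k m)
    {ff : Ω → k.Hyp} {s : Ω → S} {a : Ω → A} (hs : Measurable s) (ha : Measurable a)
    {f g : k.Hyp} (hl : Measurable fun p : Ω × Transition S A => l (ff p.1) f g p.2) (c r : ℝ) :
    Measurable fun p : Ω × S => c * (r * l.noise M (ff p.1) f g (s p.1) (a p.1) p.2
      - ‖l.expected M (ff p.1) f g (s p.1) (a p.1)‖ ^ 2 / 2) := by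
  have he : Measurable fun p : Ω × S => l.expected M (ff p.1) f g (s p.1) (a p.1) :=
    (measurable_expected M l hs ha hl).comp measurable_fst
  exact (((measurable_noise M l hs ha hl).const_mul r).sub
    ((he.norm.pow_const 2).div_const 2)).const_mul c

end Measurability

section OneStep

variable {S A : Type*} [MeasurableSpace S] [MeasurableSpace A] {M : AMDP S A}
  {k : HypothesisKind S A} {m : ℕ} {l : Discrepancy k m} {H G : Set k.Hyp}

theorem Discrepancy.IsMeasurable.measurable_transition [Finite A] [DiscreteMeasurableSpace A]
    (hm : l.IsMeasurable H G) {f' f g : k.Hyp}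
    (hf' : f' ∈ H) (hf : f ∈ H) (hg : g ∈ H ∪ G) (s : S) (a : A) :
    Measurable fun x => l f' f g (M.transition s a x) :=
  (hm f' hf' f hf g hg).comp (measurable_const.prodMk (measurable_const.prodMk
    (measurable_const.prodMk measurable_id)))

theorem Discrepancy.IsBoundedBy.norm_expected_le {b : ℝ} (hb : l.IsBoundedBy M H G b)
    {f' f g : k.Hyp} (hf' : f' ∈ H) (hf : f ∈ H) (hg : g ∈ H ∪ G) (s : S) (a : A) :
    ‖l.expected M f' f g s a‖ ≤ b := by
  simpa [Discrepancy.expected] using norm_integral_le_of_norm_le_const (μ := M.P (s, a))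
    (ae_of_all _ fun x => hb f' hf' f hf g hg s a x)

/-- Generalized completeness identifies the centred discrepancy with `l f' f (Φ f)`, so that the
centred discrepancy obeys the same norm bound as the discrepancy itself. -/
theorem Discrepancy.IsComplete.sub_expected {Φ : k.Hyp → k.Hyp} {fstar : k.Hyp}
    (hc : l.IsComplete M H G Φ fstar) {f' f g : k.Hyp} (hf' : f' ∈ H) (hf : f ∈ H)
    (hg : g ∈ H ∪ G) (s : S) (a : A) (x : S) :
    l f' f g (M.transition s a x) - l.expected M f' f g s a
      = l f' f (Φ f) (M.transition s a x) := by
  rw [← hc.decomposition f' hf' f hf g hg s a x]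
  abel

/-- The difference of the squared losses of `g` and `Φ f` is the squared conditional mean plus the
noise. -/
theorem Discrepancy.IsComplete.norm_sq_sub {Φ : k.Hyp → k.Hyp} {fstar : k.Hyp}
    (hc : l.IsComplete M H G Φ fstar) {f' f g : k.Hyp} (hf' : f' ∈ H) (hf : f ∈ H)
    (hg : g ∈ H ∪ G) (s : S) (a : A) (x : S) :
    ‖l f' f g (M.transition s a x)‖ ^ 2 - ‖l f' f (Φ f) (M.transition s a x)‖ ^ 2
      = ‖l.expected M f' f g s a‖ ^ 2 + l.noise M f' f g s a x := by
  rw [Discrepancy.noise, ← hc.sub_expected hf' hf hg s a x]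
  have := norm_add_sq_real (l.expected M f' f g s a)
    (l f' f g (M.transition s a x) - l.expected M f' f g s a)
  rw [add_sub_cancel] at this
  rw [this]; ring

/-- The noise has standard deviation proxy `2 ‖e‖ b`, of the order of the conditional mean `e`
itself. At the tilting parameter `1 / (4 b²)` half of `‖e‖²` therefore pays for the noise, of either
sign `r`. -/
theorem lintegral_exp_noise_le_one [Finite A] [DiscreteMeasurableSpace A]
    {Φ : k.Hyp → k.Hyp} {fstar : k.Hyp} {b : ℝ} (hb0 : 0 < b)
    (hm : l.IsMeasurable H G) (hb : l.IsBoundedBy M H G b)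
    (hc : l.IsComplete M H G Φ fstar) {f' f g : k.Hyp} (hf' : f' ∈ H) (hf : f ∈ H)
    (hg : g ∈ H ∪ G) (s : S) (a : A) {r : ℝ} (hr : r ^ 2 = 1) :
    ∫⁻ x, ENNReal.ofReal (Real.exp ((4 * b ^ 2)⁻¹ *
      (r * l.noise M f' f g s a x - ‖l.expected M f' f g s a‖ ^ 2 / 2))) ∂(M.P (s, a)) ≤ 1 := by
  have hmeas := hm.measurable_transition (M := M) hf' hf hg s a
  have hint : Integrable (fun x => l f' f g (M.transition s a x)) (M.P (s, a)) :=
    Integrable.of_bound hmeas.aestronglyMeasurable b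
      (ae_of_all _ fun x => hb f' hf' f hf g hg s a x)
  set e := l.expected M f' f g s a with he
  have hY : Measurable fun x => l.noise M f' f g s a x :=
    ((measurable_const (a := e)).inner (hmeas.sub_const e)).const_mul 2
  have hYb : ∀ x, |l.noise M f' f g s a x| ≤ 2 * (‖e‖ * b) := by
    intro x
    rw [Discrepancy.noise, abs_mul, abs_two, hc.sub_expected hf' hf hg s a x]
    have h1 := abs_real_inner_le_norm e (l f' f (Φ f) (M.transition s a x))
    have h2 := hb f' hf' f hf (Φ f) (Or.inr (hc.mapsTo hf)) s a x
    have := mul_le_mul_of_nonneg_left h2 (norm_nonneg e)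
    linarith
  have h0 : ∫ x, l.noise M f' f g s a x ∂(M.P (s, a)) = 0 := by
    simp only [Discrepancy.noise]
    have h1 : ∫ x, (l f' f g (M.transition s a x) - e) ∂(M.P (s, a)) = 0 := by
      rw [integral_sub hint (integrable_const _), integral_const]
      simp [he, Discrepancy.expected]
    have h2 := integral_inner (𝕜 := ℝ) (hint.sub (integrable_const e)) e
    simp only [Pi.sub_apply] at h2
    rw [integral_const_mul, ← he, h2, h1, inner_zero_right, mul_zero]
  have hv : ((4 * b ^ 2)⁻¹ * r) ^ 2 * (2 * (‖e‖ * b)) ^ 2 / 2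
      ≤ (4 * b ^ 2)⁻¹ * (‖e‖ ^ 2 / 2) := by
    rw [mul_pow, hr]
    refine le_of_eq ?_
    field_simp
    ring
  convert lintegral_exp_sub_le_one hY hYb h0 _ hv using 5
  ring

end OneStep

namespace LoopRun

variable {S : Type*} {A : Type*} [MeasurableSpace S] [MeasurableSpace A]
  {M : AMDP S A} {k : HypothesisKind S A} {H G : Set k.Hyp} {m : ℕ} {l : Discrepancy k m}
  {T : ℕ} {β : ℝ} {s₁ : S} {Ω : Type*} [mΩ : MeasurableSpace Ω] {μ : Measure Ω}
  {ℱ : Filtration ℕ mΩ} {s : ℕ → Ω → S} {a : ℕ → Ω → A} {fs : ℕ → Ω → k.Hyp}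

/-- The next state of a run has conditional law `P(· | s_t, a_t)`, for jointly measurable functions
of the past and the next state. -/
theorem lintegral_next [IsProbabilityMeasure μ] (h : LoopRun M k H G l T β s₁ μ ℱ s a fs)
    {t : ℕ} (ht : t < T) {F : Ω × S → ℝ≥0∞} (hF : Measurable[(ℱ t).prod inferInstance] F) :
    ∫⁻ ω, F (ω, s (t + 1) ω) ∂μ = ∫⁻ ω, ∫⁻ x, F (ω, x) ∂(M.P (s t ω, a t ω)) ∂μ := by
  have hsa : Measurable[ℱ t] fun ω => (s t ω, a t ω) :=
    (h.measurable_s t ht.le).prodMk (h.measurable_a t ht)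
  exact @lintegral_prodMk_eq_of_kernel Ω Ω S mΩ (ℱ t) _ μ _ id (measurable_id'' (ℱ.le t))
    (s (t + 1)) ((h.measurable_s (t + 1) ht).mono (ℱ.le _) le_rfl)
    (@Kernel.comap _ _ _ _ _ (ℱ t) M.P (fun ω => (s t ω, a t ω)) hsa)
    (@Kernel.IsMarkovKernel.comap _ _ _ _ _ (ℱ t) _ M.P _ hsa)
    (fun B hB E hE => by
      rw [Set.inter_comm, Set.inter_comm]
      exact h.transition_law t ht B hB E hE) F hF

variable [Finite A]

/-- Hoeffding's inequality for the value increments, at the tilting parameter `θ`. -/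
theorem measureReal_value_ge [IsProbabilityMeasure μ] (h : LoopRun M k H G l T β s₁ μ ℱ s a fs)
    {B : ℝ} (hB : ∀ f ∈ H, ∀ s, |k.V f s| ≤ B) (θ τ : ℝ) :
    μ.real {ω | τ ≤ ∑ i ∈ Finset.range T, (θ *
      ((∫ x, k.V (fs i ω) x ∂(M.P (s i ω, a i ω))) - k.V (fs i ω) (s (i + 1) ω))
        - θ ^ 2 * (2 * B) ^ 2 / 2)} ≤ Real.exp (-τ) := by
  have hV : ∀ i < T, Measurable[(ℱ i).prod inferInstance]
      fun p : Ω × S => k.V (fs i p.1) p.2 := fun i hi =>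
    @measurable_V S A _ _ _ k Ω (ℱ i) _ (h.measurable_Q i hi)
  rw [Finset.range_eq_Ico]
  refine measureReal_le_sum_le_exp_neg h.measurable_s (fun t ω => M.P (s t ω, a t ω))
    (fun t ht F hF => h.lintegral_next ht hF)
    (fun i p => θ * ((∫ x, k.V (fs i p.1) x ∂(M.P (s i p.1, a i p.1))) - k.V (fs i p.1) p.2)
        - θ ^ 2 * (2 * B) ^ 2 / 2)
    (fun i hi => ?_) (fun i hi ω => ?_) 0 le_rfl τ
  · exact ((@measurable_value_increment S A _ _ _ M k Ω (ℱ i) _ _ _ (h.measurable_s i hi.le)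
      (h.measurable_a i hi) (h.measurable_Q i hi)).const_mul θ).sub_const _
  · have hVω : Measurable fun x => k.V (fs i ω) x :=
      (hV i hi).comp (@measurable_prodMk_left Ω S (ℱ i) _ ω)
    have hint : Integrable (fun x => k.V (fs i ω) x) (M.P (s i ω, a i ω)) :=
      Integrable.of_bound hVω.aestronglyMeasurable B
        (ae_of_all _ fun x => hB _ (h.mem i hi ω) x)
    refine lintegral_exp_sub_le_one
      (Y := fun x => (∫ x, k.V (fs i ω) x ∂(M.P (s i ω, a i ω))) - k.V (fs i ω) x)
      (hVω.const_sub _) (fun x => ?_) ?_ θ le_rfl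
    · have h1 : |∫ x, k.V (fs i ω) x ∂(M.P (s i ω, a i ω))| ≤ B := by
        simpa using norm_integral_le_of_norm_le_const (μ := M.P (s i ω, a i ω))
          (f := k.V (fs i ω)) (C := B) (ae_of_all _ fun x => hB _ (h.mem i hi ω) x)
      have h2 := hB _ (h.mem i hi ω) x
      exact (abs_sub _ _).trans (by linarith)
    · rw [integral_sub (integrable_const _) hint]
      simp

variable [DiscreteMeasurableSpace A]

/-- Concentration of the noise around a fixed pair `(f, g)`, for either sign `r`. -/
theorem measureReal_noise_ge [IsProbabilityMeasure μ] (h : LoopRun M k H G l T β s₁ μ ℱ s a fs)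
    {Φ : k.Hyp → k.Hyp} {fstar : k.Hyp} {b : ℝ} (hb0 : 0 < b)
    (hm : l.IsMeasurable H G) (hb : l.IsBoundedBy M H G b)
    (hc : l.IsComplete M H G Φ fstar) {f g : k.Hyp} (hf : f ∈ H)
    (hg : g ∈ H ∪ G) {r : ℝ} (hr : r ^ 2 = 1) (t₀ : ℕ) {t : ℕ} (ht : t ≤ T) (τ : ℝ) :
    μ.real {ω | τ ≤ ∑ i ∈ Finset.Ico t₀ t, (4 * b ^ 2)⁻¹ *
      (r * l.noise M (fs i ω) f g (s i ω) (a i ω) (s (i + 1) ω)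
        - ‖l.expected M (fs i ω) f g (s i ω) (a i ω)‖ ^ 2 / 2)} ≤ Real.exp (-τ) := by
  refine measureReal_le_sum_le_exp_neg h.measurable_s (fun t ω => M.P (s t ω, a t ω))
    (fun t ht F hF => h.lintegral_next ht hF)
    (fun i p => (4 * b ^ 2)⁻¹ * (r * l.noise M (fs i p.1) f g (s i p.1) (a i p.1) p.2
        - ‖l.expected M (fs i p.1) f g (s i p.1) (a i p.1)‖ ^ 2 / 2))
    (fun i hi => ?_) (fun i hi ω => ?_) t₀ ht τ
  · exact @measurable_tilted_noise S A _ _ _ M k _ m Ω (ℱ i) l _ _ _ (h.measurable_s i hi.le)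
      (h.measurable_a i hi) f g (h.measurable_l i hi f hf g hg) _ r
  · exact lintegral_exp_noise_le_one hb0 hm hb hc (h.mem i hi ω) hf hg _ _ hr

end LoopRun

/-! ### Covers and uniform concentration -/

namespace HypothesisKind

variable {S A : Type*} [MeasurableSpace S] [MeasurableSpace A] (k : HypothesisKind S A)

theorem supDist_comm (f g : k.Hyp) : k.supDist f g = k.supDist g f := by
  cases k <;> simp only [supDist, edist_comm]

theorem supDist_triangle (f g h : k.Hyp) : k.supDist f h ≤ k.supDist f g + k.supDist g h := by
  cases k with
  | valueBased =>
    refine max_le (iSup₂_le fun s a => ?_) ?_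
    · exact (edist_triangle _ (Prod.fst g s a) _).trans (add_le_add
        ((le_iSup₂ (f := fun s a => edist (Prod.fst f s a) (Prod.fst g s a)) s a).trans
          (le_max_left _ _))
        ((le_iSup₂ (f := fun s a => edist (Prod.fst g s a) (Prod.fst h s a)) s a).trans
          (le_max_left _ _)))
    · exact (edist_triangle _ (Prod.snd g) _).trans
        (add_le_add (le_max_right _ _) (le_max_right _ _))
  | modelBased q j =>
    refine max_le (iSup_le fun x => iSup₂_le fun B hB => ?_) (iSup₂_le fun s a => ?_)
    · exact (edist_triangle _ ((AMDP.P g x).real B) _).trans (add_le_add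
        (le_max_of_le_left (le_iSup_of_le x (le_iSup_of_le B (le_iSup_of_le hB le_rfl))))
        (le_max_of_le_left (le_iSup_of_le x (le_iSup_of_le B (le_iSup_of_le hB le_rfl)))))
    · exact (edist_triangle _ (AMDP.r g s a) _).trans (add_le_add
        ((le_iSup₂ (f := fun s a => edist (AMDP.r f s a) (AMDP.r g s a)) s a).trans
          (le_max_right _ _))
        ((le_iSup₂ (f := fun s a => edist (AMDP.r g s a) (AMDP.r h s a)) s a).trans
          (le_max_right _ _)))

variable {k}

theorem exists_cover_of_coveringNumber_eq {ρ : ℝ≥0∞} {F : Set k.Hyp} {N : ℕ}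
    (h : k.coveringNumber ρ F = N) :
    ∃ C : Finset k.Hyp, (C : Set k.Hyp) ⊆ F ∧ (∀ f ∈ F, ∃ g ∈ C, k.supDist f g ≤ ρ) ∧
      C.card ≤ N := by
  by_contra! hcon
  have : ((N + 1 : ℕ) : ℕ∞) ≤ k.coveringNumber ρ F :=
    le_iInf₂ fun C hC => by exact_mod_cast hcon C hC.1 hC.2
  rw [h] at this
  have : N + 1 ≤ N := by exact_mod_cast this
  omega

/-- Moving the centres of a cover into a subclass doubles its radius. -/
theorem exists_cover_subset {ρ : ℝ≥0∞} {F H : Set k.Hyp} (hH : H ⊆ F) {C : Finset k.Hyp}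
    (hC : ∀ f ∈ F, ∃ g ∈ C, k.supDist f g ≤ ρ) :
    ∃ D : Finset k.Hyp, (D : Set k.Hyp) ⊆ H ∧ (∀ f ∈ H, ∃ g ∈ D, k.supDist f g ≤ ρ + ρ) ∧
      D.card ≤ C.card := by
  classical
  have hφ : ∀ c, ∃ f, (∃ f' ∈ H, k.supDist f' c ≤ ρ) → f ∈ H ∧ k.supDist f c ≤ ρ := by
    intro c
    by_cases h : ∃ f' ∈ H, k.supDist f' c ≤ ρ
    · exact ⟨h.choose, fun _ => h.choose_spec⟩
    · exact ⟨c, fun h' => absurd h' h⟩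
  choose φ hφ using hφ
  refine ⟨(C.filter fun c => ∃ f' ∈ H, k.supDist f' c ≤ ρ).image φ, ?_, fun f hf => ?_,
    Finset.card_image_le.trans (Finset.card_filter_le _ _)⟩
  · intro f hf
    obtain ⟨c, hc, rfl⟩ := Finset.mem_image.1 hf
    exact (hφ c (Finset.mem_filter.1 hc).2).1
  · obtain ⟨c, hc, hd⟩ := hC f (hH hf)
    have hex : ∃ f' ∈ H, k.supDist f' c ≤ ρ := ⟨f, hf, hd⟩
    refine ⟨φ c, Finset.mem_image_of_mem _ (Finset.mem_filter.2 ⟨hc, hex⟩), ?_⟩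
    refine (k.supDist_triangle f c (φ c)).trans (add_le_add hd ?_)
    rw [supDist_comm]
    exact (hφ c hex).2

end HypothesisKind

section Perturbation

variable {S A : Type*} [MeasurableSpace S] [MeasurableSpace A] {M : AMDP S A}
  {k : HypothesisKind S A} {m : ℕ} {l : Discrepancy k m} {H G : Set k.Hyp}

theorem Discrepancy.IsLipschitz.norm_sub_le {Λ ρ : ℝ} (hl : l.IsLipschitz M H G Λ) (hΛ : 0 ≤ Λ)
    (hρ : 0 ≤ ρ) {f' f₁ f₂ g₁ g₂ : k.Hyp} (hf' : f' ∈ H) (hf₁ : f₁ ∈ H) (hf₂ : f₂ ∈ H)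
    (hg₁ : g₁ ∈ H ∪ G) (hg₂ : g₂ ∈ H ∪ G) (hf : k.supDist f₁ f₂ ≤ ENNReal.ofReal ρ)
    (hg : k.supDist g₁ g₂ ≤ ENNReal.ofReal ρ) (s : S) (a : A) (x : S) :
    ‖l f' f₁ g₁ (M.transition s a x) - l f' f₂ g₂ (M.transition s a x)‖ ≤ Λ * ρ := by
  rw [← dist_eq_norm, ← edist_le_ofReal (mul_nonneg hΛ hρ), ENNReal.ofReal_mul hΛ]
  exact (hl f' hf' f₁ hf₁ f₂ hf₂ g₁ hg₁ g₂ hg₂ s a x).trans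
    (mul_le_mul_right (max_le hf hg) _)

theorem abs_inner_sub_inner_le {E : Type*} [NormedAddCommGroup E] [InnerProductSpace ℝ E]
    {e e' u u' : E} {b η : ℝ} (he' : ‖e'‖ ≤ b) (hu : ‖u - e‖ ≤ b)
    (hee : ‖e - e'‖ ≤ η) (huu : ‖u - u'‖ ≤ η) (hb : 0 ≤ b) :
    |2 * inner ℝ e (u - e) - 2 * inner ℝ e' (u' - e')| ≤ 6 * b * η := by
  have hsplit : inner ℝ e (u - e) - inner ℝ e' (u' - e')
      = inner ℝ (e - e') (u - e) + inner ℝ e' ((u - u') - (e - e')) := by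
    simp only [inner_sub_left, inner_sub_right]
    ring
  have hη : 0 ≤ η := (norm_nonneg _).trans hee
  have h1 : |inner ℝ (e - e') (u - e)| ≤ η * b :=
    (abs_real_inner_le_norm _ _).trans (mul_le_mul hee hu (norm_nonneg _) hη)
  have h2 : |inner ℝ e' ((u - u') - (e - e'))| ≤ b * (η + η) :=
    (abs_real_inner_le_norm _ _).trans (mul_le_mul he'
      ((norm_sub_le _ _).trans (add_le_add huu hee)) (norm_nonneg _) hb)
  rw [← mul_sub, hsplit, abs_mul, abs_two]
  have h3 := abs_add_le (inner ℝ (e - e') (u - e)) (inner ℝ e' ((u - u') - (e - e')))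
  linarith

theorem norm_sq_sub_norm_sq_le {E : Type*} [SeminormedAddCommGroup E] {e e' : E} {b η : ℝ}
    (he : ‖e‖ ≤ b) (he' : ‖e'‖ ≤ b) (hee : ‖e - e'‖ ≤ η) : ‖e'‖ ^ 2 - ‖e‖ ^ 2 ≤ 2 * b * η := by
  have h1 : ‖e'‖ - ‖e‖ ≤ η := by
    rw [norm_sub_rev] at hee
    exact (norm_sub_norm_le _ _).trans hee
  have h2 : 0 ≤ η := (norm_nonneg _).trans hee
  nlinarith [norm_nonneg e, norm_nonneg e']

variable [Finite A] [DiscreteMeasurableSpace A]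

theorem norm_expected_sub_le {b η : ℝ} (hm : l.IsMeasurable H G) (hb : l.IsBoundedBy M H G b)
    {f' f₁ f₂ g₁ g₂ : k.Hyp} (hf' : f' ∈ H) (hf₁ : f₁ ∈ H) (hf₂ : f₂ ∈ H)
    (hg₁ : g₁ ∈ H ∪ G) (hg₂ : g₂ ∈ H ∪ G) (s : S) (a : A)
    (h : ∀ x, ‖l f' f₁ g₁ (M.transition s a x) - l f' f₂ g₂ (M.transition s a x)‖ ≤ η) :
    ‖l.expected M f' f₁ g₁ s a - l.expected M f' f₂ g₂ s a‖ ≤ η := by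
  have hint : ∀ f ∈ H, ∀ g ∈ H ∪ G,
      Integrable (fun x => l f' f g (M.transition s a x)) (M.P (s, a)) := fun f hf g hg =>
    Integrable.of_bound (hm.measurable_transition hf' hf hg s a).aestronglyMeasurable b
      (ae_of_all _ fun x => hb f' hf' f hf g hg s a x)
  rw [Discrepancy.expected, Discrepancy.expected,
    ← integral_sub (hint f₁ hf₁ g₁ hg₁) (hint f₂ hf₂ g₂ hg₂)]
  simpa using norm_integral_le_of_norm_le_const (μ := M.P (s, a)) (ae_of_all _ h)

/-- Stability of the noise under replacing `(f, g)` by a pair of centres of a cover. The map `Φ`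
need not be continuous: `l f' f (Φ f)` is the difference of `l f' f g` and its conditional mean,
both of which are Lipschitz in `(f, g)`. -/
theorem abs_noise_sub_le {Φ : k.Hyp → k.Hyp} {fstar : k.Hyp} {b η : ℝ} (hb0 : 0 ≤ b)
    (hm : l.IsMeasurable H G) (hb : l.IsBoundedBy M H G b) (hc : l.IsComplete M H G Φ fstar)
    {f' f₁ f₂ g₁ g₂ : k.Hyp} (hf' : f' ∈ H) (hf₁ : f₁ ∈ H) (hf₂ : f₂ ∈ H)
    (hg₁ : g₁ ∈ H ∪ G) (hg₂ : g₂ ∈ H ∪ G) (s : S) (a : A)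
    (h : ∀ x, ‖l f' f₁ g₁ (M.transition s a x) - l f' f₂ g₂ (M.transition s a x)‖ ≤ η) (x : S) :
    |l.noise M f' f₁ g₁ s a x - l.noise M f' f₂ g₂ s a x| ≤ 6 * b * η := by
  have he := norm_expected_sub_le hm hb hf' hf₁ hf₂ hg₁ hg₂ s a h
  have hu : ‖l f' f₁ g₁ (M.transition s a x) - l.expected M f' f₁ g₁ s a‖ ≤ b := by
    rw [hc.sub_expected hf' hf₁ hg₁]
    exact hb f' hf' f₁ hf₁ _ (Or.inr (hc.mapsTo hf₁)) s a x
  exact abs_inner_sub_inner_le (hb.norm_expected_le hf' hf₂ hg₂ s a) hu he (h x) hb0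

end Perturbation

namespace LoopRun

variable {S : Type*} {A : Type*} [MeasurableSpace S] [MeasurableSpace A]
  {M : AMDP S A} {k : HypothesisKind S A} {H G : Set k.Hyp} {m : ℕ} {l : Discrepancy k m}
  {T : ℕ} {β : ℝ} {s₁ : S} {Ω : Type*} [mΩ : MeasurableSpace Ω] {μ : Measure Ω}
  {ℱ : Filtration ℕ mΩ} {s : ℕ → Ω → S} {a : ℕ → Ω → A} {fs : ℕ → Ω → k.Hyp}
  [Finite A] [DiscreteMeasurableSpace A]

/-- Uniform concentration: outside an event of small probability, the noise accumulated over every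
window of steps is dominated, simultaneously for all `f` and `g`, by half of the squared
conditional means. -/
theorem measureReal_exists_noise_gt [IsProbabilityMeasure μ]
    (h : LoopRun M k H G l T β s₁ μ ℱ s a fs)
    {Φ : k.Hyp → k.Hyp} {fstar : k.Hyp} {b Λ : ℝ} (hb0 : 0 < b) (hΛ : 0 ≤ Λ) (hT : 1 ≤ T)
    (hm : l.IsMeasurable H G) (hb : l.IsBoundedBy M H G b) (hl : l.IsLipschitz M H G Λ)
    (hc : l.IsComplete M H G Φ fstar) {N : ℕ}
    (hN : k.coveringNumber (T : ENNReal)⁻¹ (H ∪ G) = N) (τ : ℝ) :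
    μ.real {ω | ∃ f ∈ H, ∃ g ∈ H ∪ G, ∃ t₀ ≤ T, ∃ t ≤ T,
      (∑ i ∈ Finset.Ico t₀ t, ‖l.expected M (fs i ω) f g (s i ω) (a i ω)‖ ^ 2) / 2
        + 4 * b ^ 2 * τ + 14 * b * Λ
      < |∑ i ∈ Finset.Ico t₀ t, l.noise M (fs i ω) f g (s i ω) (a i ω) (s (i + 1) ω)|}
      ≤ 2 * (T + 1) ^ 2 * N ^ 2 * Real.exp (-τ) := by
  obtain ⟨C, hCsub, hCcov, hCcard⟩ := HypothesisKind.exists_cover_of_coveringNumber_eq hN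
  obtain ⟨D, hDsub, hDcov, hDcard⟩ :=
    HypothesisKind.exists_cover_subset Set.subset_union_left hCcov
  have hT0 : (0 : ℝ) < T := by exact_mod_cast hT
  have hρ : ((T : ENNReal)⁻¹ + (T : ENNReal)⁻¹) = ENNReal.ofReal (2 / T) := by
    rw [← two_mul, ENNReal.ofReal_div_of_pos hT0, ENNReal.ofReal_natCast, ENNReal.ofReal_ofNat,
      div_eq_mul_inv]
  let I : Finset (k.Hyp × k.Hyp × ℕ × ℕ × ℝ) :=
    D ×ˢ C ×ˢ Finset.range (T + 1) ×ˢ Finset.range (T + 1) ×ˢ {1, -1}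
  let bad : k.Hyp × k.Hyp × ℕ × ℕ × ℝ → Set Ω := fun q =>
    {ω | τ ≤ ∑ i ∈ Finset.Ico q.2.2.1 q.2.2.2.1, (4 * b ^ 2)⁻¹ *
      (q.2.2.2.2 * l.noise M (fs i ω) q.1 q.2.1 (s i ω) (a i ω) (s (i + 1) ω)
        - ‖l.expected M (fs i ω) q.1 q.2.1 (s i ω) (a i ω)‖ ^ 2 / 2)}
  have hbad : ∀ q ∈ I, μ.real (bad q) ≤ Real.exp (-τ) := by
    rintro ⟨f, g, t₀, t, r⟩ hq
    simp only [I, Finset.mem_product, Finset.mem_range, Finset.mem_insert,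
      Finset.mem_singleton] at hq
    obtain ⟨hf, hg, -, ht, hr⟩ := hq
    refine h.measureReal_noise_ge hb0 hm hb hc (hDsub hf) (hCsub hg) ?_ t₀ (Nat.lt_succ_iff.1 ht) τ
    rcases hr with rfl | rfl <;> norm_num
  have hcard : (I.card : ℝ) ≤ 2 * (T + 1) ^ 2 * N ^ 2 := by
    have h2 : ({1, -1} : Finset ℝ).card ≤ 2 := Finset.card_le_two
    have h3 : I.card ≤ N * (N * ((T + 1) * ((T + 1) * 2))) := by
      simp only [I, Finset.card_product, Finset.card_range]
      have := hDcard.trans hCcard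
      gcongr
    calc (I.card : ℝ) ≤ (N * (N * ((T + 1) * ((T + 1) * 2))) : ℕ) := by exact_mod_cast h3
      _ = _ := by push_cast; ring
  calc μ.real _ ≤ μ.real (⋃ q ∈ I, bad q) := measureReal_mono ?_ (measure_ne_top _ _)
    _ ≤ ∑ q ∈ I, μ.real (bad q) := measureReal_biUnion_finset_le _ _
    _ ≤ ∑ q ∈ I, Real.exp (-τ) := Finset.sum_le_sum hbad
    _ = I.card * Real.exp (-τ) := by rw [Finset.sum_const, nsmul_eq_mul]
    _ ≤ _ := mul_le_mul_of_nonneg_right hcard (Real.exp_nonneg _)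
  rintro ω ⟨f, hf, g, hg, t₀, ht₀, t, ht, hlt⟩
  obtain ⟨c, hcD, hfc⟩ := hDcov f hf
  obtain ⟨c', hcC, hgc⟩ := hCcov g hg
  rw [hρ] at hfc
  have hgc' : k.supDist g c' ≤ ENNReal.ofReal (2 / T) := by
    rw [← hρ]
    exact hgc.trans le_self_add
  have hη : ∀ i ∈ Finset.Ico t₀ t, ∀ x, ‖l (fs i ω) f g (M.transition (s i ω) (a i ω) x)
      - l (fs i ω) c c' (M.transition (s i ω) (a i ω) x)‖ ≤ Λ * (2 / T) := fun i hi x =>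
    hl.norm_sub_le hΛ (by positivity) (h.mem i (by have := (Finset.mem_Ico.1 hi).2; omega) ω) hf
      (hDsub hcD) hg (hCsub hcC) hfc hgc' _ _ x
  have hcount : ((Finset.Ico t₀ t).card : ℝ) ≤ T := by
    rw [Nat.card_Ico]
    exact_mod_cast (Nat.sub_le t t₀).trans ht
  have hbΛ : 0 ≤ b * (Λ * (2 / T)) := by positivity
  have hTT : (T : ℝ) * (b * (Λ * (2 / T))) = 2 * b * Λ := by field_simp
  have hnoise : |∑ i ∈ Finset.Ico t₀ t, l.noise M (fs i ω) f g (s i ω) (a i ω) (s (i + 1) ω)|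
      ≤ |∑ i ∈ Finset.Ico t₀ t, l.noise M (fs i ω) c c' (s i ω) (a i ω) (s (i + 1) ω)|
        + 12 * b * Λ := by
    have h1 : |∑ i ∈ Finset.Ico t₀ t, (l.noise M (fs i ω) f g (s i ω) (a i ω) (s (i + 1) ω)
        - l.noise M (fs i ω) c c' (s i ω) (a i ω) (s (i + 1) ω))|
        ≤ (Finset.Ico t₀ t).card • (6 * b * (Λ * (2 / T))) :=
      (Finset.abs_sum_le_sum_abs _ _).trans (Finset.sum_le_card_nsmul _ _ _ fun i hi =>
        abs_noise_sub_le hb0.le hm hb hc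
          (h.mem i (by have := (Finset.mem_Ico.1 hi).2; omega) ω) hf (hDsub hcD) hg (hCsub hcC)
          _ _ (hη i hi) _)
    rw [Finset.sum_sub_distrib, nsmul_eq_mul] at h1
    have h2 := abs_sub_abs_le_abs_sub
      (∑ i ∈ Finset.Ico t₀ t, l.noise M (fs i ω) f g (s i ω) (a i ω) (s (i + 1) ω))
      (∑ i ∈ Finset.Ico t₀ t, l.noise M (fs i ω) c c' (s i ω) (a i ω) (s (i + 1) ω))
    nlinarith [mul_le_mul_of_nonneg_right hcount hbΛ]
  have hmean : (∑ i ∈ Finset.Ico t₀ t, ‖l.expected M (fs i ω) c c' (s i ω) (a i ω)‖ ^ 2)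
      ≤ (∑ i ∈ Finset.Ico t₀ t, ‖l.expected M (fs i ω) f g (s i ω) (a i ω)‖ ^ 2)
        + 4 * b * Λ := by
    have h1 : ∑ i ∈ Finset.Ico t₀ t, (‖l.expected M (fs i ω) c c' (s i ω) (a i ω)‖ ^ 2
        - ‖l.expected M (fs i ω) f g (s i ω) (a i ω)‖ ^ 2)
        ≤ (Finset.Ico t₀ t).card • (2 * b * (Λ * (2 / T))) :=
      Finset.sum_le_card_nsmul _ _ _ fun i hi => by
        have hi' := h.mem i (by have := (Finset.mem_Ico.1 hi).2; omega) ω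
        exact norm_sq_sub_norm_sq_le (hb.norm_expected_le hi' hf hg _ _)
          (hb.norm_expected_le hi' (hDsub hcD) (hCsub hcC) _ _)
          (norm_expected_sub_le hm hb hi' hf (hDsub hcD) hg (hCsub hcC) _ _ (hη i hi))
    rw [Finset.sum_sub_distrib, nsmul_eq_mul] at h1
    nlinarith [mul_le_mul_of_nonneg_right hcount hbΛ]
  obtain ⟨r, hr, hrabs⟩ : ∃ r : ℝ, (r = 1 ∨ r = -1) ∧
      r * (∑ i ∈ Finset.Ico t₀ t, l.noise M (fs i ω) c c' (s i ω) (a i ω) (s (i + 1) ω))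
        = |∑ i ∈ Finset.Ico t₀ t, l.noise M (fs i ω) c c' (s i ω) (a i ω) (s (i + 1) ω)| := by
    rcases abs_choice
      (∑ i ∈ Finset.Ico t₀ t, l.noise M (fs i ω) c c' (s i ω) (a i ω) (s (i + 1) ω)) with h | h
    · exact ⟨1, Or.inl rfl, by rw [h, one_mul]⟩
    · exact ⟨-1, Or.inr rfl, by rw [h, neg_one_mul]⟩
  refine Set.mem_iUnion₂.2 ⟨(c, c', t₀, t, r), ?_, ?_⟩
  · simp only [I, Finset.mem_product, Finset.mem_range, Finset.mem_insert, Finset.mem_singleton]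
    exact ⟨hcD, hcC, by omega, by omega, hr⟩
  · simp only [bad, Set.mem_ofPred_eq]
    rw [← Finset.mul_sum, Finset.sum_sub_distrib, ← Finset.mul_sum, ← Finset.sum_div, hrabs,
      inv_mul_eq_div, le_div_iff₀ (by positivity)]
    linarith

end LoopRun

/-! ### Analysis of a trajectory with controlled noise -/

section Counting

variable {α : Type*} {f : ℕ → α} {U : ℕ → Prop} [DecidablePred U] {T : ℕ}

/-- If the weight between two consecutive updates is at least `β`, then the number of updates
after the first step is at most the total weight divided by `β`. -/
theorem mul_card_updates_le {w : ℕ → ℝ} (hw : ∀ i, 0 ≤ w i) {β : ℝ} (hU0 : U 0)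
    (hretain : ∀ t, t + 1 < T → ¬ U (t + 1) → f (t + 1) = f t)
    (hstep : ∀ t₀ t, t₀ < t → t < T → U t₀ → U t → (∀ i ∈ Finset.Ico t₀ t, f i = f t₀) →
      β ≤ ∑ i ∈ Finset.Ico t₀ t, w i) :
    β * ((Finset.Ico 1 T).filter U).card ≤ ∑ i ∈ Finset.range T, w i := by
  have key : ∀ n < T, ∃ t₀ ≤ n, U t₀ ∧ (∀ i ∈ Finset.Ico t₀ (n + 1), f i = f t₀) ∧
      β * ((Finset.Ico 1 (n + 1)).filter U).card ≤ ∑ i ∈ Finset.range t₀, w i := by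
    intro n
    induction n with
    | zero => exact fun _ => ⟨0, le_rfl, hU0, by simp, by simp⟩
    | succ n ih =>
      intro hn
      obtain ⟨t₀, ht₀, hU, hf, hcard⟩ := ih (by omega)
      rw [← Finset.insert_Ico_right_eq_Ico_add_one (by omega : 1 ≤ n + 1), Finset.filter_insert]
      by_cases hUn : U (n + 1)
      · refine ⟨n + 1, le_rfl, hUn, by simp, ?_⟩
        rw [if_pos hUn, Finset.card_insert_of_notMem (by simp)]
        have h1 := hstep t₀ (n + 1) (by omega) hn hU hUn hf
        have h2 := Finset.sum_range_add_sum_Ico w (by omega : t₀ ≤ n + 1)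
        push_cast
        linarith
      · refine ⟨t₀, by omega, hU, fun i hi => ?_, by rwa [if_neg hUn]⟩
        rcases eq_or_ne i (n + 1) with rfl | hne
        · rw [hretain n hn hUn]
          exact hf n (by simp; omega)
        · exact hf i (by simp at hi ⊢; omega)
  rcases T with _ | T
  · simp
  · obtain ⟨t₀, ht₀, -, -, h⟩ := key T (by omega)
    exact h.trans (Finset.sum_le_sum_of_subset_of_nonneg
      (Finset.range_subset_range.2 (by omega)) fun i _ _ => hw i)

/-- The increments of a value function that changes only at updates telescope up to the number of
updates. -/
theorem sum_value_increments_le {S : Type*} {v : α → S → ℝ} {s : ℕ → S} {B : ℝ} (hT : 1 ≤ T)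
    (hv : ∀ t < T, ∀ x, |v (f t) x| ≤ B)
    (hretain : ∀ t, t + 1 < T → ¬ U (t + 1) → f (t + 1) = f t) :
    ∑ t ∈ Finset.range T, (v (f t) (s (t + 1)) - v (f t) (s t))
      ≤ 2 * B * (((Finset.Ico 1 T).filter U).card + 1) := by
  have key : ∀ n < T, ∑ t ∈ Finset.range (n + 1), (v (f t) (s (t + 1)) - v (f t) (s t))
      ≤ v (f n) (s (n + 1)) - v (f 0) (s 0)
        + 2 * B * ((Finset.Ico 1 (n + 1)).filter U).card := by
    intro n
    induction n with
    | zero => simp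
    | succ n ih =>
      intro hn
      rw [Finset.sum_range_succ, ← Finset.insert_Ico_right_eq_Ico_add_one (by omega : 1 ≤ n + 1),
        Finset.filter_insert]
      have h1 := ih (by omega)
      by_cases hUn : U (n + 1)
      · rw [if_pos hUn, Finset.card_insert_of_notMem (by simp)]
        have h2 := abs_le.1 (hv n (by omega) (s (n + 1)))
        have h3 := abs_le.1 (hv (n + 1) hn (s (n + 1)))
        push_cast
        linarith
      · rw [if_neg hUn, hretain n hn hUn]
        linarith
  obtain ⟨n, rfl⟩ : ∃ n, T = n + 1 := ⟨T - 1, by omega⟩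
  have h1 := key n (by omega)
  have h2 := abs_le.1 (hv n (by omega) (s (n + 1)))
  have h3 := abs_le.1 (hv 0 (by omega) (s 0))
  linarith

end Counting

section Trajectory

variable {S A : Type*} [MeasurableSpace S] [MeasurableSpace A] {M : AMDP S A}
  {k : HypothesisKind S A} {m : ℕ} {l : Discrepancy k m} {H G : Set k.Hyp}
  {Φ : k.Hyp → k.Hyp} {fstar : k.Hyp} {fs : ℕ → k.Hyp} {s : ℕ → S} {a : ℕ → A} {T : ℕ} {β : ℝ}

/-- The noise accumulated over every window of a trajectory is at most half of the accumulated
squared conditional means plus `β / 4`. -/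
def Discrepancy.NoiseControlled (l : Discrepancy k m) (M : AMDP S A) (H G : Set k.Hyp) (T : ℕ)
    (β : ℝ) (fs : ℕ → k.Hyp) (s : ℕ → S) (a : ℕ → A) : Prop :=
  ∀ f ∈ H, ∀ g ∈ H ∪ G, ∀ t₀ ≤ T, ∀ t ≤ T,
    |∑ i ∈ Finset.Ico t₀ t, l.noise M (fs i) f g (s i) (a i) (s (i + 1))|
      ≤ (∑ i ∈ Finset.Ico t₀ t, ‖l.expected M (fs i) f g (s i) (a i)‖ ^ 2) / 2 + β / 4

theorem Discrepancy.IsComplete.loss_sub_loss (hc : l.IsComplete M H G Φ fstar)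
    (hmem : ∀ t < T, fs t ∈ H) {t : ℕ} (ht : t ≤ T) {f g : k.Hyp} (hf : f ∈ H) (hg : g ∈ H ∪ G) :
    l.loss M fs s a t f g - l.loss M fs s a t f (Φ f)
      = (∑ i ∈ Finset.range t, ‖l.expected M (fs i) f g (s i) (a i)‖ ^ 2)
        + ∑ i ∈ Finset.range t, l.noise M (fs i) f g (s i) (a i) (s (i + 1)) := by
  rw [Discrepancy.loss, Discrepancy.loss, ← Finset.sum_sub_distrib, ← Finset.sum_add_distrib]
  exact Finset.sum_congr rfl fun i hi =>
    hc.norm_sq_sub (hmem i ((Finset.mem_range.1 hi).trans_le ht)) hf hg _ _ _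

/-- The competitor `Φ f` bounds the excess loss of `f` from below. -/
theorem Discrepancy.IsComplete.le_excessLoss (hc : l.IsComplete M H G Φ fstar)
    (hmem : ∀ t < T, fs t ∈ H) {t : ℕ} (ht : t ≤ T) {f : k.Hyp} (hf : f ∈ H) :
    (∑ i ∈ Finset.range t, ‖l.expected M (fs i) f f (s i) (a i)‖ ^ 2)
        + ∑ i ∈ Finset.range t, l.noise M (fs i) f f (s i) (a i) (s (i + 1))
      ≤ l.excessLoss M G fs s a t f := by
  have hbdd : BddBelow (Set.range fun g : G => l.loss M fs s a t f g) :=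
    ⟨0, by rintro _ ⟨g, rfl⟩; exact Finset.sum_nonneg fun i _ => sq_nonneg _⟩
  have h1 := ciInf_le hbdd ⟨Φ f, hc.mapsTo hf⟩
  have h2 := hc.loss_sub_loss (s := s) (a := a) hmem ht hf (Or.inl hf)
  rw [Discrepancy.excessLoss]
  linarith

/-- No competitor `g` beats `Φ f` by more than `β / 4`. -/
theorem Discrepancy.NoiseControlled.excessLoss_le
    (hn : l.NoiseControlled M H G T β fs s a) (hc : l.IsComplete M H G Φ fstar)
    (hmem : ∀ t < T, fs t ∈ H) {t : ℕ} (ht : t ≤ T) {f : k.Hyp} (hf : f ∈ H) :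
    l.excessLoss M G fs s a t f
      ≤ (∑ i ∈ Finset.range t, ‖l.expected M (fs i) f f (s i) (a i)‖ ^ 2)
        + (∑ i ∈ Finset.range t, l.noise M (fs i) f f (s i) (a i) (s (i + 1))) + β / 4 := by
  have : Nonempty G := ⟨⟨Φ f, hc.mapsTo hf⟩⟩
  have h1 : l.loss M fs s a t f (Φ f) - β / 4 ≤ ⨅ g : G, l.loss M fs s a t f g := by
    refine le_ciInf fun g => ?_
    have h2 := hc.loss_sub_loss (s := s) (a := a) hmem ht hf (Or.inr g.2)
    have h3 := (abs_le.1 (hn f hf g (Or.inr g.2) 0 (Nat.zero_le _) t ht)).1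
    rw [← Finset.range_eq_Ico] at h3
    have h4 : 0 ≤ ∑ i ∈ Finset.range t, ‖l.expected M (fs i) f g (s i) (a i)‖ ^ 2 :=
      Finset.sum_nonneg fun i _ => sq_nonneg _
    linarith
  have h2 := hc.loss_sub_loss (s := s) (a := a) hmem ht hf (Or.inl hf)
  rw [Discrepancy.excessLoss]
  linarith

/-- The optimal hypothesis stays in all confidence sets. -/
theorem Discrepancy.NoiseControlled.fstar_mem_confidenceSet
    (hn : l.NoiseControlled M H G T β fs s a) (hc : l.IsComplete M H G Φ fstar)
    (hmem : ∀ t < T, fs t ∈ H) (hβ : 0 ≤ β) (hstar : fstar ∈ H) {t : ℕ} (ht : t ≤ T) :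
    fstar ∈ l.confidenceSet M H G β fs s a t := by
  refine ⟨hstar, ?_⟩
  have h1 := hn.excessLoss_le hc hmem ht hstar
  have h2 : ∀ i ∈ Finset.range t, l.expected M (fs i) fstar fstar (s i) (a i) = 0 := by
    intro i hi
    rw [← hc.decomposition (fs i) (hmem i ((Finset.mem_range.1 hi).trans_le ht)) fstar hstar
      fstar (Or.inl hstar) (s i) (a i) (s i), hc.fixed, sub_self]
  rw [Finset.sum_eq_zero fun i hi => by rw [h2 i hi]; simp,
    Finset.sum_eq_zero fun i hi => by rw [Discrepancy.noise, h2 i hi]; simp] at h1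
  linarith

variable
  (hupdate : ∀ t < T, l.IsUpdate M G β fs s a t → (l.confidenceSet M H G β fs s a t).Nonempty →
    fs t ∈ l.confidenceSet M H G β fs s a t ∧
      ∀ f ∈ l.confidenceSet M H G β fs s a t, k.J f ≤ k.J (fs t))
  (hretain : ∀ t < T, ¬ l.IsUpdate M G β fs s a t → fs t = fs (t - 1))

include hupdate hretain

/-- Since the optimal hypothesis is never excluded, every selected hypothesis is optimistic. -/
theorem Discrepancy.NoiseControlled.optimism
    (hn : l.NoiseControlled M H G T β fs s a) (hc : l.IsComplete M H G Φ fstar)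
    (hmem : ∀ t < T, fs t ∈ H) (hβ : 0 ≤ β) (hstar : fstar ∈ H) :
    ∀ t < T, k.J fstar ≤ k.J (fs t) := by
  have hup : ∀ t < T, l.IsUpdate M G β fs s a t → k.J fstar ≤ k.J (fs t) := fun t ht hU =>
    have hmemc := hn.fstar_mem_confidenceSet hc hmem hβ hstar ht.le
    (hupdate t ht hU ⟨fstar, hmemc⟩).2 fstar hmemc
  intro t
  induction t with
  | zero => exact fun ht => hup 0 ht (Or.inl rfl)
  | succ t ih =>
    intro ht
    by_cases hU : l.IsUpdate M G β fs s a (t + 1)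
    · exact hup _ ht hU
    · rw [hretain _ ht hU]
      exact ih (by omega)

/-- The selected hypothesis has small discrepancy on the past: right after an update its excess
loss is at most `β`, and without an update it is below `4β`. -/
theorem Discrepancy.NoiseControlled.sum_norm_sq_expected_le
    (hn : l.NoiseControlled M H G T β fs s a) (hc : l.IsComplete M H G Φ fstar)
    (hmem : ∀ t < T, fs t ∈ H) (hβ : 0 ≤ β) (hstar : fstar ∈ H) {t : ℕ} (ht : t < T) :
    ∑ i ∈ Finset.range t, ‖l.expected M (fs i) (fs t) (fs t) (s i) (a i)‖ ^ 2 ≤ 9 * β := by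
  have h1 : l.excessLoss M G fs s a t (fs t) ≤ 4 * β := by
    by_cases hU : l.IsUpdate M G β fs s a t
    · have := (hupdate t ht hU
        ⟨fstar, hn.fstar_mem_confidenceSet hc hmem hβ hstar ht.le⟩).1.2
      linarith
    · rw [hretain t ht hU]
      simp only [Discrepancy.IsUpdate, not_or, not_le] at hU
      exact hU.2.le
  have h2 := hc.le_excessLoss (s := s) (a := a) hmem ht.le (hmem t ht)
  have h3 := (abs_le.1 (hn _ (hmem t ht) _ (Or.inl (hmem t ht)) 0 (Nat.zero_le _) t ht.le)).1
  rw [← Finset.range_eq_Ico] at h3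
  linarith

omit hretain in
/-- Between two updates of the hypothesis its squared conditional mean discrepancies accumulate to
at least `β`. -/
theorem Discrepancy.NoiseControlled.le_sum_between_updates
    (hn : l.NoiseControlled M H G T β fs s a) (hc : l.IsComplete M H G Φ fstar)
    (hmem : ∀ t < T, fs t ∈ H) (hβ : 0 ≤ β) (hstar : fstar ∈ H) {t₀ t : ℕ} (htt : t₀ < t)
    (ht : t < T) (hU₀ : l.IsUpdate M G β fs s a t₀) (hU : l.IsUpdate M G β fs s a t)
    (hf : ∀ i ∈ Finset.Ico t₀ t, fs i = fs t₀) :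
    β ≤ ∑ i ∈ Finset.Ico t₀ t, ‖l.expected M (fs i) (fs i) (fs i) (s i) (a i)‖ ^ 2 := by
  have ht₀ : t₀ < T := htt.trans ht
  have hH := hmem t₀ ht₀
  have h1 := (hupdate t₀ ht₀ hU₀
    ⟨fstar, hn.fstar_mem_confidenceSet hc hmem hβ hstar ht₀.le⟩).1.2
  have h2 : 4 * β ≤ l.excessLoss M G fs s a t (fs t₀) := by
    rcases hU with h | h
    · omega
    · rwa [hf (t - 1) (Finset.mem_Ico.2 (by omega))] at h
  have h3 := hc.le_excessLoss (s := s) (a := a) hmem ht₀.le hH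
  have h4 := hn.excessLoss_le hc hmem ht.le hH
  have h5 := (abs_le.1 (hn _ hH _ (Or.inl hH) t₀ ht₀.le t ht.le)).2
  rw [← Finset.sum_range_add_sum_Ico _ htt.le,
    ← Finset.sum_range_add_sum_Ico (fun i => l.noise M _ _ _ _ _ _) htt.le] at h4
  have h6 : ∑ i ∈ Finset.Ico t₀ t, ‖l.expected M (fs i) (fs i) (fs i) (s i) (a i)‖ ^ 2
      = ∑ i ∈ Finset.Ico t₀ t, ‖l.expected M (fs i) (fs t₀) (fs t₀) (s i) (a i)‖ ^ 2 :=
    Finset.sum_congr rfl fun i hi => by rw [hf i hi]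
  rw [h6]
  linarith

omit hupdate hretain in
/-- The decomposition of the regret into Bellman errors, value noise and value increments. -/
theorem regret_le_of_optimism [Finite A] [Nonempty A] {Jstar : ℝ}
    (hJ : ∀ t < T, Jstar ≤ k.J (fs t))
    (hgreedy : ∀ t < T, ∀ b, k.Q (fs t) (s t) b ≤ k.Q (fs t) (s t) (a t)) :
    regret M Jstar T s a ≤
      (∑ t ∈ Finset.range T, M.bellmanError (k.Q (fs t)) (k.J (fs t)) (s t) (a t))
      + (∑ t ∈ Finset.range T,
          ((∫ x, k.V (fs t) x ∂(M.P (s t, a t))) - k.V (fs t) (s (t + 1))))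
      + ∑ t ∈ Finset.range T, (k.V (fs t) (s (t + 1)) - k.V (fs t) (s t)) := by
  rw [regret, ← Finset.sum_add_distrib, ← Finset.sum_add_distrib]
  refine Finset.sum_le_sum fun t ht => ?_
  have ht := Finset.mem_range.1 ht
  have h1 := hJ t ht
  have h2 : k.V (fs t) (s t) = k.Q (fs t) (s t) (a t) :=
    le_antisymm (ciSup_le (hgreedy t ht)) (le_ciSup (Set.finite_range _).bddAbove (a t))
  rw [AMDP.bellmanError, AMDP.bellmanOp, h2]
  simp only [HypothesisKind.V]
  linarith

end Trajectory

/-! ### The regret bound -/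

/-- A finite run in `H` extends to an endless sequence in `H`, as the coefficients require. -/
theorem exists_extension_mem {α : Type*} {H : Set α} {fs : ℕ → α} {T : ℕ} (hne : H.Nonempty)
    (hmem : ∀ t < T, fs t ∈ H) : ∃ f : ℕ → α, (∀ t, f t ∈ H) ∧ ∀ t < T, f t = fs t := by
  obtain ⟨f₀, hf₀⟩ := hne
  refine ⟨fun t => if t < T then fs t else f₀, fun t => ?_, fun t ht => if_pos ht⟩
  by_cases ht : t < T
  · simpa only [if_pos ht] using hmem t ht
  · simpa only [if_neg ht] using hf₀

section Coefficients

variable {S A : Type*} [MeasurableSpace S] [MeasurableSpace A] {M : AMDP S A}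
  {k : HypothesisKind S A} {m : ℕ} {l : Discrepancy k m} {H : Set k.Hyp}
  {fs : ℕ → k.Hyp} {s : ℕ → S} {a : ℕ → A} {T : ℕ} {σ ε : ℝ}

theorem sum_bellmanError_le_of_mem_dominanceSet {C₁ d B : ℝ}
    (hd : d ∈ l.dominanceSet M H T C₁ σ ε) (hne : H.Nonempty) (hmem : ∀ t < T, fs t ∈ H)
    (hB : ∀ t < T, ∑ i ∈ Finset.range t,
      ‖l.expected M (fs i) (fs t) (fs t) (s i) (a i)‖ ^ 2 ≤ B) :
    ∑ t ∈ Finset.range T, M.bellmanError (k.Q (fs t)) (k.J (fs t)) (s t) (a t)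
      ≤ √(d * (T * B)) + C₁ * σ * min d T + T * ε := by
  obtain ⟨f', hmem', hf'⟩ := exists_extension_mem hne hmem
  have h1 := hd.2 f' s a hmem'
  rw [Finset.sum_congr rfl fun t ht => by rw [hf' t (Finset.mem_range.1 ht)]] at h1
  refine h1.trans ?_
  gcongr
  · exact hd.1.le
  · refine (Finset.sum_le_card_nsmul _ _ B fun t ht => ?_).trans (by simp)
    have ht := Finset.mem_range.1 ht
    rw [hf' t ht]
    refine (Finset.sum_congr rfl fun i hi => ?_).trans_le (hB t ht)
    rw [hf' i ((Finset.mem_range.1 hi).trans ht)]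

theorem sum_norm_sq_expected_le_of_mem_transferabilitySet {C₂ κ B : ℝ} (hB0 : 0 < B)
    (hκ : κ ∈ l.transferabilitySet M H T C₂ σ ε) (hne : H.Nonempty) (hmem : ∀ t < T, fs t ∈ H)
    (hB : ∀ t < T, ∑ i ∈ Finset.range t,
      ‖l.expected M (fs i) (fs t) (fs t) (s i) (a i)‖ ^ 2 ≤ B) :
    ∑ t ∈ Finset.range T, ‖l.expected M (fs t) (fs t) (fs t) (s t) (a t)‖ ^ 2
      ≤ κ * B * Real.log T + C₂ * σ ^ 2 * min κ T + 2 * T * ε ^ 2 := by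
  obtain ⟨f', hmem', hf'⟩ := exists_extension_mem hne hmem
  have h1 := hκ.2 B f' s a hB0 hmem' fun t ht => by
    rw [hf' t ht]
    refine (Finset.sum_congr rfl fun i hi => ?_).trans_le (hB t ht)
    rw [hf' i ((Finset.mem_range.1 hi).trans ht)]
  refine (Finset.sum_congr rfl fun t ht => ?_).trans_le h1
  rw [hf' t (Finset.mem_range.1 ht)]

end Coefficients

/-- The arithmetic of the regret bound: `E`, `Z`, `W` bound the Bellman errors, the value noise
and the value increments, and `n` is the number of updates after the first step. -/
theorem regret_arithmetic {C₁ C₂ CV σ β d κ dG κG n E Z W K : ℝ} {T : ℝ}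
    (hC₁ : 0 < C₁) (hCV : 0 < CV) (hσ : 0 < σ) (hT : 1 ≤ T) (hβ : 2 ≤ β)
    (hβC₂ : C₂ * σ ^ 2 ≤ β) (hd0 : 0 < d) (hd : d < dG + 1) (hκ0 : 0 < κ) (hκ : κ < κG + 1)
    (hK : 6 + 2 * C₁ + 83 * CV ≤ K) (hdG : 0 ≤ dG)
    (hE : E ≤ √(d * (T * (9 * β))) + C₁ * σ * min d T + T * (1 / √T))
    (hZ : Z ≤ 3 * (CV * σ) * √(T * β))
    (hW : W ≤ 2 * (CV * σ) * (n + 1))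
    (hn : β * n ≤ κ * (9 * β) * Real.log T + C₂ * σ ^ 2 * min κ T + 2 * T * (1 / √T) ^ 2) :
    E + Z + W ≤ K * max 1 (1 / σ) * (σ * max 1 (max √dG κG) * √(T * β)) := by
  set D := max 1 (max √dG κG) with hD
  have hD1 : 1 ≤ D := le_max_left _ _
  have hdD : d ≤ 2 * D ^ 2 := by
    have h1 : √dG ≤ D := (le_max_left _ _).trans (le_max_right _ _)
    have h2 : dG ≤ D ^ 2 := by
      rw [← Real.sq_sqrt hdG]
      exact pow_le_pow_left₀ (Real.sqrt_nonneg _) h1 2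
    nlinarith
  have hκD : κ ≤ 2 * D := by
    have h1 : κG ≤ D := (le_max_right _ _).trans (le_max_right _ _)
    linarith
  set R := √(T * β) with hR
  have hRT : √T ≤ R := Real.sqrt_le_sqrt (by nlinarith)
  have hT1 : 1 ≤ √T := Real.one_le_sqrt.2 hT
  have hTT : √T * √T = T := Real.mul_self_sqrt (by linarith)
  have hRR : R ^ 2 = T * β := Real.sq_sqrt (by nlinarith)
  have hR1 : 1 ≤ R := hT1.trans hRT
  have hDR : 1 ≤ D * R := one_le_mul_of_one_le_of_one_le hD1 hR1
  have hDT : √T ≤ D * R := hRT.trans (le_mul_of_one_le_left (by linarith) hD1)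
  have h1 : √(d * (T * (9 * β))) ≤ 5 * (D * R) := by
    refine Real.sqrt_le_iff.2 ⟨by positivity, ?_⟩
    have : (5 * (D * R)) ^ 2 = 25 * D ^ 2 * (T * β) := by rw [← hRR]; ring
    rw [this]
    have h0 : 0 ≤ T * β := by rw [← hRR]; positivity
    nlinarith
  have h2 : min d T ≤ 2 * (D * R) := by
    have h3 : min d T ≤ 2 * (D * √T) := by
      refine le_of_sq_le_sq ?_ (by positivity)
      have hm0 : 0 ≤ min d T := le_min hd0.le (by linarith)
      have h4 : min d T ^ 2 ≤ d * T := by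
        rw [sq]
        exact mul_le_mul (min_le_left _ _) (min_le_right _ _) hm0 hd0.le
      have h5 : (2 * (D * √T)) ^ 2 = 4 * D ^ 2 * T := by
        rw [mul_pow, mul_pow, Real.sq_sqrt (by linarith)]; ring
      rw [h5]
      nlinarith
    exact h3.trans (by gcongr)
  have h3 : T * (1 / √T) = √T := by
    rw [mul_one_div, Real.div_sqrt]
  have hlog : Real.log T ≤ 2 * √T := by
    have := Real.log_le_sub_one_of_pos (by linarith : 0 < √T)
    rw [Real.log_sqrt (by linarith)] at this
    linarith
  have hlog0 : 0 ≤ Real.log T := Real.log_nonneg hT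
  -- `β` exceeds both burn-in terms, so they contribute at most `κ + 1` updates
  have hn' : n ≤ 39 * (D * R) := by
    have h4 : 2 * T * (1 / √T) ^ 2 = 2 := by
      rw [div_pow, one_pow, Real.sq_sqrt (by linarith)]
      field_simp
    have h5 : β * n ≤ β * (9 * κ * Real.log T + κ + 1) := by
      have h6 : C₂ * σ ^ 2 * min κ T ≤ β * κ :=
        mul_le_mul hβC₂ (min_le_left _ _) (le_min hκ0.le (by linarith)) (by linarith)
      rw [h4] at hn
      linarith
    have h6 : n ≤ 9 * κ * Real.log T + κ + 1 := le_of_mul_le_mul_left h5 (by linarith)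
    have h7 : κ * Real.log T ≤ (2 * D) * (2 * R) :=
      mul_le_mul hκD (hlog.trans (by linarith)) hlog0 (by linarith)
    have h8 : D ≤ D * R := le_mul_of_one_le_right (by linarith) hR1
    linarith
  have h4 : E + Z + W ≤ (6 + (2 * C₁ + 83 * CV) * σ) * (D * R) := by
    have h5 : C₁ * σ * min d T ≤ C₁ * σ * (2 * (D * R)) :=
      mul_le_mul_of_nonneg_left h2 (by positivity)
    have h6 : R ≤ D * R := le_mul_of_one_le_left (by linarith) hD1
    have h7 : 3 * (CV * σ) * R ≤ 3 * (CV * σ) * (D * R) :=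
      mul_le_mul_of_nonneg_left h6 (by positivity)
    have h8 : 2 * (CV * σ) * (n + 1) ≤ 2 * (CV * σ) * (40 * (D * R)) :=
      mul_le_mul_of_nonneg_left (by linarith) (by positivity)
    rw [h3] at hE
    linarith
  have h5 : max 1 (1 / σ) * σ = max σ 1 := by
    rw [max_mul_of_nonneg _ _ hσ.le, one_mul, one_div, inv_mul_cancel₀ hσ.ne']
  have h6 : 6 + (2 * C₁ + 83 * CV) * σ ≤ K * max σ 1 := by
    have h7 : σ ≤ max σ 1 := le_max_left _ _
    have h8 : 1 ≤ max σ 1 := le_max_right _ _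
    have h9 : (2 * C₁ + 83 * CV) * σ ≤ (2 * C₁ + 83 * CV) * max σ 1 :=
      mul_le_mul_of_nonneg_left h7 (by positivity)
    have h10 : (6 + 2 * C₁ + 83 * CV) * max σ 1 ≤ K * max σ 1 :=
      mul_le_mul_of_nonneg_right hK (by linarith)
    linarith
  calc E + Z + W ≤ (6 + (2 * C₁ + 83 * CV) * σ) * (D * R) := h4
    _ ≤ (K * max σ 1) * (D * R) := mul_le_mul_of_nonneg_right h6 (by linarith)
    _ = _ := by rw [← h5]; ring

/-- Optimizing the tilting parameter in Hoeffding's inequality. -/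
theorem sum_lt_of_tilted_sum_lt {ι : Type*} {I : Finset ι} {y : ι → ℝ} {B τ : ℝ} {T : ℝ}
    (hcard : (I.card : ℝ) = T) (hT : 0 < T) (hB : 0 < B) (hτ : 0 < τ)
    (h : ∑ i ∈ I, (√(τ / T) / B * y i - (√(τ / T) / B) ^ 2 * (2 * B) ^ 2 / 2) < τ) :
    ∑ i ∈ I, y i < 3 * B * √(T * τ) := by
  rw [Finset.sum_sub_distrib, ← Finset.mul_sum, Finset.sum_const, nsmul_eq_mul, hcard] at h
  have h1 : (√(τ / T) / B) ^ 2 * (2 * B) ^ 2 / 2 = 2 * (τ / T) := by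
    rw [div_pow, Real.sq_sqrt (by positivity)]
    field_simp
  have h2 : T * (2 * (τ / T)) = 2 * τ := by field_simp
  rw [h1, h2] at h
  have h3 : √(τ / T) * √(T * τ) = τ := by
    rw [← Real.sqrt_mul (by positivity), show τ / T * (T * τ) = τ * τ by field_simp,
      Real.sqrt_mul_self hτ.le]
  have hpos : 0 < √(τ / T) / B := by positivity
  refine lt_of_mul_lt_mul_left ?_ hpos.le
  have h4 : √(τ / T) / B * (3 * B * √(T * τ)) = 3 * τ := by
    rw [show √(τ / T) / B * (3 * B * √(T * τ)) = 3 * (√(τ / T) * √(T * τ)) by field_simp, h3]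
  linarith

theorem theorem1 (C₁ C₂ Cl CV L : ℝ)
    (hC₁ : 0 < C₁) (hC₂ : 0 < C₂) (hCl : 0 < Cl) (hCV : 0 < CV) (hL : 0 < L) :
    ∃ K : ℝ, 0 < K ∧
      ∀ (S : Type u) (A : Type v) [MeasurableSpace S] [Finite A] [Nonempty A]
        [MeasurableSpace A] [DiscreteMeasurableSpace A]
        (M : AMDP S A) (Qstar : S → A → ℝ) (Jstar : ℝ)
        (k : HypothesisKind S A) (H G : Set k.Hyp) (fstar : k.Hyp)
        (m : ℕ) (l : Discrepancy k m) (Φ : k.Hyp → k.Hyp) (σ : ℝ),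
        σ = span (greedyValue Qstar) → 0 < σ →
        M.IsBellmanSolution Qstar Jstar →
        k.IsHypothesisClass H →
        k.IsOptimalHypothesis M Qstar Jstar fstar → fstar ∈ H →
        (∀ f ∈ H, ∀ s, |k.V f s| ≤ CV * σ) →
        l.IsMeasurable H G →
        l.IsBoundedBy M H G (Cl * σ) →
        l.IsLipschitz M H G (L * (1 + σ)) →
        l.IsComplete M H G Φ fstar →
        ∀ c : ℝ, K * (1 + σ + 1 / σ) ≤ c →
        ∀ (T : ℕ) (δ : ℝ), 1 ≤ T → 0 < δ → δ < 1 →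
        ∀ N : ℕ, k.coveringNumber (T : ENNReal)⁻¹ (H ∪ G) = N →
        (l.dominanceSet M H T C₁ σ (1 / √T)).Nonempty →
        (l.transferabilitySet M H T C₂ σ (1 / √T)).Nonempty →
        ∀ (s₁ : S) (Ω : Type w) [mΩ : MeasurableSpace Ω] (μ : MeasureTheory.Measure Ω)
          [MeasureTheory.IsProbabilityMeasure μ] (ℱ : MeasureTheory.Filtration ℕ mΩ)
          (s : ℕ → Ω → S) (a : ℕ → Ω → A) (fs : ℕ → Ω → k.Hyp),
          LoopRun M k H G l T (optimismParam c T N δ σ) s₁ μ ℱ s a fs →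
          1 - 5 * δ ≤ μ.real {ω |
            regret M Jstar T (fun t => s t ω) (fun t => a t ω) ≤
              K * max 1 (1 / σ) *
                (σ * max 1 (max √(l.dominanceCoeff M H T C₁ σ (1 / √T))
                    (l.transferabilityCoeff M H T C₂ σ (1 / √T))) *
                  √(T * optimismParam c T N δ σ))} := by
  -- the first three terms come from the regret bound, the fourth from the burn-in of
  -- transferability, the last two make the concentration error at most `β / 4`
  refine ⟨6 + 2 * C₁ + 83 * CV + C₂ + 32 * Cl ^ 2 + 56 * (Cl * L), by positivity, ?_⟩
  set K := 6 + 2 * C₁ + 83 * CV + C₂ + 32 * Cl ^ 2 + 56 * (Cl * L) with hK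
  intro S A _ _ _ _ _ M Qstar Jstar k H G fstar m l Φ σ _ hσ _ _ hopt hstar hV hm hb hl hc c hcK
    T δ hT hδ0 hδ1 N hN hdne hκne s₁ Ω mΩ μ _ ℱ s a fs h
  have hClL : 0 < Cl * L := mul_pos hCl hL
  have hCl2 : 0 < Cl ^ 2 := pow_pos hCl 2
  -- for `δ` close to `1` the logarithm in `β` need not be bounded away from `0`
  rcases le_or_gt (1 / 5) δ with hδ | hδ
  · exact le_trans (by linarith) measureReal_nonneg
  have hT1 : (1 : ℝ) ≤ T := by exact_mod_cast hT
  have hN1 : (1 : ℝ) ≤ N := by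
    obtain ⟨C, -, hC, hcard⟩ := HypothesisKind.exists_cover_of_coveringNumber_eq hN
    obtain ⟨g, hg, -⟩ := hC fstar (Or.inl hstar)
    exact_mod_cast (Finset.card_pos.2 ⟨g, hg⟩).trans_le hcard
  have hq0 : 0 < T * (N : ℝ) ^ 2 / δ := by positivity
  have hTN : 1 ≤ T * (N : ℝ) ^ 2 := one_le_mul_of_one_le_of_one_le hT1 (one_le_pow₀ hN1)
  set τ := Real.log (T * (N : ℝ) ^ 2 / δ) with hτ
  have hexp : Real.exp (-τ) = δ / (T * (N : ℝ) ^ 2) := by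
    rw [Real.exp_neg, hτ, Real.exp_log hq0, inv_div]
  have hτ1 : 1 ≤ τ := by
    rw [hτ, Real.le_log_iff_exp_le hq0, le_div_iff₀ hδ0]
    have h1 : Real.exp 1 * δ ≤ 3 * (1 / 5) :=
      mul_le_mul Real.exp_one_lt_three.le hδ.le hδ0.le (by norm_num)
    linarith
  set β := optimismParam c T N δ σ with hβdef
  have hβ : K * (1 + σ + σ ^ 2) * τ ≤ β := by
    have h1 : K * (1 + σ + 1 / σ) * (τ * σ) ≤ c * (τ * σ) :=
      mul_le_mul_of_nonneg_right hcK (by positivity)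
    have h2 : K * (1 + σ + 1 / σ) * (τ * σ) = K * (1 + σ + σ ^ 2) * τ := by
      field_simp
      ring
    rw [hβdef, optimismParam, ← hτ]
    linarith
  -- every lower-order term is a constant at most `K` times a quantity at most `(1 + σ + σ²) τ`
  have hK' : ∀ x y : ℝ, 0 ≤ x → x ≤ K → 0 ≤ y → y ≤ (1 + σ + σ ^ 2) * τ → x * y ≤ β :=
    fun x y hx hxK hy hy' => by
      refine (mul_le_mul hxK hy' hy (hx.trans hxK)).trans (le_trans (le_of_eq ?_) hβ)
      ring
  have hσ2 : 0 < σ ^ 2 := pow_pos hσ 2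
  have hσ1 : 1 ≤ 1 + σ + σ ^ 2 := by linarith
  have hσ1τ : 1 + σ + σ ^ 2 ≤ (1 + σ + σ ^ 2) * τ := le_mul_of_one_le_right (by linarith) hτ1
  have hτβ : τ ≤ β := by
    have := hK' 1 τ zero_le_one (by linarith) (by linarith)
      (le_mul_of_one_le_left (by linarith) hσ1)
    linarith
  have hβ2 : 2 ≤ β := by
    have := hK' 2 1 (by norm_num) (by linarith) zero_le_one (by linarith)
    linarith
  have hβC₂ : C₂ * σ ^ 2 ≤ β := hK' C₂ _ hC₂.le (by linarith) hσ2.le (by linarith)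
  have hβ4 : 4 * (Cl * σ) ^ 2 * (2 * τ) + 14 * (Cl * σ) * (L * (1 + σ)) ≤ β / 4 := by
    have h1 := hK' (32 * Cl ^ 2 + 56 * (Cl * L)) ((1 + σ + σ ^ 2) * τ) (by positivity)
      (by linarith) (by positivity) le_rfl
    have h2 : Cl ^ 2 * (σ ^ 2 * τ) ≤ Cl ^ 2 * ((1 + σ + σ ^ 2) * τ) :=
      mul_le_mul_of_nonneg_left (mul_le_mul_of_nonneg_right (by linarith) (by linarith)) hCl2.le
    have h3 : Cl * L * (σ + σ ^ 2) ≤ Cl * L * ((1 + σ + σ ^ 2) * τ) :=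
      mul_le_mul_of_nonneg_left (by linarith) hClL.le
    linarith
  have hne : H.Nonempty := ⟨fstar, hstar⟩
  have hJstar : k.J fstar = Jstar := by
    cases k with
    | valueBased =>
      change fstar = (Qstar, Jstar) at hopt
      rw [hopt]
      rfl
    | modelBased q j =>
      obtain ⟨h1, -, h3⟩ := hopt
      rw [← h3, ← h1]
      rfl
  have hbV : 0 < CV * σ := mul_pos hCV hσ
  -- the infima need not be attained
  obtain ⟨d, hd, hdlt⟩ := exists_lt_of_csInf_lt hdne
    (lt_add_one (l.dominanceCoeff M H T C₁ σ (1 / √T)))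
  obtain ⟨κ, hκ, hκlt⟩ := exists_lt_of_csInf_lt hκne
    (lt_add_one (l.transferabilityCoeff M H T C₂ σ (1 / √T)))
  have hdG : 0 ≤ l.dominanceCoeff M H T C₁ σ (1 / √T) :=
    Real.sInf_nonneg fun x hx => hx.1.le
  -- `τ` is doubled since the union bound runs over pairs of times, about `T²` windows
  have hbad1 := h.measureReal_exists_noise_gt (mul_pos hCl hσ)
    (by positivity : 0 ≤ L * (1 + σ)) hT hm hb hl hc hN (2 * τ)
  have hbad2 := h.measureReal_value_ge hV (√(τ / T) / (CV * σ)) τ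
  set bad1 := {ω | ∃ f ∈ H, ∃ g ∈ H ∪ G, ∃ t₀ ≤ T, ∃ t ≤ T,
      (∑ i ∈ Finset.Ico t₀ t, ‖l.expected M (fs i ω) f g (s i ω) (a i ω)‖ ^ 2) / 2
        + 4 * (Cl * σ) ^ 2 * (2 * τ) + 14 * (Cl * σ) * (L * (1 + σ))
      < |∑ i ∈ Finset.Ico t₀ t, l.noise M (fs i ω) f g (s i ω) (a i ω) (s (i + 1) ω)|}
  set bad2 := {ω | τ ≤ ∑ i ∈ Finset.range T, (√(τ / T) / (CV * σ) *
      ((∫ x, k.V (fs i ω) x ∂(M.P (s i ω, a i ω))) - k.V (fs i ω) (s (i + 1) ω))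
        - (√(τ / T) / (CV * σ)) ^ 2 * (2 * (CV * σ)) ^ 2 / 2)}
  have hp1 : μ.real bad1 ≤ 2 * δ := by
    refine hbad1.trans ?_
    rw [show -(2 * τ) = -τ + -τ by ring, Real.exp_add, hexp]
    have h1 : 2 * ((T : ℝ) + 1) ^ 2 * N ^ 2 * (δ / (T * N ^ 2) * (δ / (T * N ^ 2)))
        = 2 * ((T + 1) / T) ^ 2 * δ ^ 2 / N ^ 2 := by
      field_simp
    have h2 : ((T : ℝ) + 1) / T ≤ 2 := by
      rw [div_le_iff₀ (by linarith)]
      linarith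
    have h3 : (((T : ℝ) + 1) / T) ^ 2 ≤ 2 ^ 2 := pow_le_pow_left₀ (by positivity) h2 2
    rw [h1]
    refine (div_le_self (by positivity) (one_le_pow₀ hN1)).trans ?_
    have h4 : δ ^ 2 ≤ δ * (1 / 5) := by
      rw [sq]
      exact mul_le_mul_of_nonneg_left hδ.le hδ0.le
    have h5 := mul_le_mul h3 h4 (sq_nonneg δ) (by norm_num)
    linarith
  have hp2 : μ.real bad2 ≤ δ := by
    refine hbad2.trans ?_
    rw [hexp]
    exact div_le_self hδ0.le hTN
  have hcover : Set.univ ⊆ {ω |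
            regret M Jstar T (fun t => s t ω) (fun t => a t ω) ≤
              K * max 1 (1 / σ) *
                (σ * max 1 (max √(l.dominanceCoeff M H T C₁ σ (1 / √T))
                    (l.transferabilityCoeff M H T C₂ σ (1 / √T))) *
                  √(T * β))} ∪ (bad1 ∪ bad2) := by
    classical
    intro ω _
    by_cases h1 : ω ∈ bad1
    · exact Or.inr (Or.inl h1)
    by_cases h2 : ω ∈ bad2
    · exact Or.inr (Or.inr h2)
    refine Or.inl ?_
    have hnoise : l.NoiseControlled M H G T β (fun t => fs t ω) (fun t => s t ω)
        (fun t => a t ω) := by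
      intro f hf g hg t₀ ht₀ t ht
      by_contra! hcon
      exact h1 ⟨f, hf, g, hg, t₀, ht₀, t, ht, lt_of_le_of_lt (by linarith) hcon⟩
    have hval := sum_lt_of_tilted_sum_lt (congrArg Nat.cast (Finset.card_range T)) (by linarith) hbV
      (by linarith) (not_le.1 h2)
    have hmem : ∀ t < T, fs t ω ∈ H := fun t ht => h.mem t ht ω
    have hup := fun t (ht : t < T) => h.update t ht ω
    have hret := fun t (ht : t < T) => h.retain t ht ω
    have hβ0 : 0 ≤ β := by linarith
    have hin := fun t (ht : t < T) =>
      hnoise.sum_norm_sq_expected_le hup hret hc hmem hβ0 hstar ht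
    have hret' : ∀ t, t + 1 < T → ¬ l.IsUpdate M G β (fun t => fs t ω) (fun t => s t ω)
        (fun t => a t ω) (t + 1) → fs (t + 1) ω = fs t ω := fun t ht hU => hret (t + 1) ht hU
    have hcount := mul_card_updates_le (β := β)
      (w := fun t => ‖l.expected M (fs t ω) (fs t ω) (fs t ω) (s t ω) (a t ω)‖ ^ 2)
      (fun _ => sq_nonneg _) (Or.inl rfl) hret' fun t₀ t htt ht hU₀ hU hf =>
        hnoise.le_sum_between_updates hup hc hmem hβ0 hstar htt ht hU₀ hU hf
    have hinc := sum_value_increments_le (v := k.V) (s := fun t => s t ω) hT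
      (fun t ht x => hV _ (hmem t ht) x) hret'
    refine (regret_le_of_optimism (hJstar ▸ hnoise.optimism hup hret hc hmem hβ0 hstar)
      fun t ht => h.greedy t ht ω).trans ?_
    refine regret_arithmetic hC₁ hCV hσ hT1 hβ2 hβC₂ hd.1 hdlt hκ.1 hκlt (by linarith) hdG
      (sum_bellmanError_le_of_mem_dominanceSet hd hne hmem hin)
      (hval.le.trans ?_) hinc
      (hcount.trans (sum_norm_sq_expected_le_of_mem_transferabilitySet (by linarith) hκ hne hmem
        hin))
    exact mul_le_mul_of_nonneg_left (Real.sqrt_le_sqrt (by gcongr)) (by positivity)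
  have htotal := (measureReal_mono hcover (measure_ne_top μ _)).trans
    ((measureReal_union_le _ _).trans (add_le_add_right (measureReal_union_le _ _) _))
  rw [probReal_univ] at htotal
  linarith
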